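/- Let $\xi(s)=\tfrac12 s(s-1)\pi^{-s/2}\Gamma(s/2)\zeta(s)$ be Riemann's entire xi function, let $\psi(x)=\sum_{n\ge1}e^{-n^2\pi x}$ for $x>0$, and for $x>1$ put $$\phi(x)=\frac{d}{dx}\bigl[x^{3/2}\psi'(x)\bigr]\cdot\frac{\log x}{x^{1/2}-1},\qquad \phi_1(x)=\frac{d}{dx}\bigl[x^{3/2}\psi'(x)\bigr]\cdot\frac{2\pi}{x^{1/2}+1}.$$ For a function $f$ on $\mathbb C$, its value at the Bernoulli operator $B$ is defined by $$f(B):=\int_{-\infty}^{\infty}\frac{\pi}{2\cosh^2(\pi t)}\,f\bigl(\tfrac12+it\bigr)\,dt$$ whenever this integral converges absolutely. In an expression such as $\sin(\pi B)\cdot\xi(B+s)$ the product $w\mapsto \sin(\pi w)\,\xi(w+s)$ is formed first and then evaluated at $B$. **Theorem 2.1.** (0) This is an evaluation of the umbral Bernoulli operator: all the integrals defining the following values converge absolutely, and $B^n=B_n$ for all $n\ge0$ (the Bernoulli numbers with $B_1=1/2$); $e^{-Bz}=\dfrac{z}{e^z-1}$ for real $z\ne0$; and $\sin(\pi B)\,e^{-Bz}=\dfrac{\pi}{e^z+1}$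 for real $z$. (1) For every $s\in\mathbb C$ the integrals defining $\xi(B+s)$ and $\sin(\pi B)\cdot\xi(B+s)$ converge absolutely, and $$\xi(B+s)=\int_1^\infty\phi(x)\,(x^{s/2}+x^{-s/2})\,dx,\qquad \sin(\pi B)\cdot\xi(B+s)=\int_1^\infty\phi_1(x)\,(x^{s/2}+x^{-s/2})\,dx,$$ where the integrals on the right also converge absolutely. (2) For every $s\in\mathbb C$, $$\xi(B+s)=\xi(B-s),\qquad \sin(\pi B)\cdot\xi(B+s)=\sin(\pi B)\cdot\xi(B-s).$$ (3) For every real $s$, the values $\xi(B+s)$ and $\sin(\pi B)\cdot\xi(B+s)$ are real and positive. (4) Each of the functions $s\mapsto\xi(B+s)$ and $s\mapsto\sin(\pi B)\cdot\xi(B+s)$ has infinitely many zeros on the imaginary axis. -/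

import Mathlib

/-- Riemann's entire function `ξ(s) = ½ s (s - 1) π^(-s/2) Γ(s/2) ζ(s)`.  It is written through
Mathlib's entire function `Λ₀(s) = Λ(s) + 1/s + 1/(1-s)`, where `Λ(s) = π^(-s/2) Γ(s/2) ζ(s)`, so
that the removable singularities are filled in; see the two lemmas below. -/
noncomputable def entireXi (s : ℂ) : ℂ :=
  (s * (s - 1) * completedRiemannZeta₀ s + 1) / 2

theorem entireXi_eq_completed {s : ℂ} (h0 : s ≠ 0) (h1 : s ≠ 1) :
    entireXi s = s * (s - 1) / 2 * completedRiemannZeta s := by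
  have h1' : (1 : ℂ) - s ≠ 0 := sub_ne_zero.mpr (Ne.symm h1)
  rw [entireXi, completedRiemannZeta_eq]
  field_simp
  ring

theorem entireXi_eq_zeta {s : ℂ} (h0 : 0 < s.re) (h1 : s ≠ 1) :
    entireXi s = s * (s - 1) / 2 * ((Real.pi : ℂ) ^ (-s / 2) * Complex.Gamma (s / 2))
      * riemannZeta s := by
  have hs : s ≠ 0 := by
    rintro rfl
    simp at h0
  have hG := Complex.Gammaℝ_ne_zero_of_re_pos h0
  rw [entireXi_eq_completed hs h1, riemannZeta_def_of_ne_zero hs, ← Complex.Gammaℝ_def]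
  field_simp

/-- The density `(π/2) sech²(π t)` of the probability law of `L`, where `B = 1/2 + i L` is the
standard realization of the Bernoulli umbra (with `B₁ = 1/2`). -/
noncomputable def bernoulliDensity (t : ℝ) : ℝ :=
  Real.pi / 2 / Real.cosh (Real.pi * t) ^ 2

/-- The function `f` can be evaluated at the Bernoulli operator: the integral defining `f(B)`
converges absolutely. -/
def BernoulliEvaluable (f : ℂ → ℂ) : Prop :=
  MeasureTheory.Integrable
    (fun t : ℝ => (bernoulliDensity t : ℂ) * f (1 / 2 + (t : ℂ) * Complex.I))
    MeasureTheory.volume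

/-- The value `f(B)` of `f` at the Bernoulli operator `B`,
`f(B) = ∫ (π/2) sech²(π t) f(1/2 + i t) dt`: the linear functional that sends `wⁿ` to the
Bernoulli number `Bₙ` (with `B₁ = 1/2`) and `e^(-wz)` to `z/(e^z - 1)`. -/
noncomputable def bernoulliEval (f : ℂ → ℂ) : ℂ :=
  ∫ t : ℝ, (bernoulliDensity t : ℂ) * f (1 / 2 + (t : ℂ) * Complex.I)

/-- The Bernoulli operator function `ξ(B + s)`. -/
noncomputable def xiB (s : ℂ) : ℂ :=
  bernoulliEval (fun w => entireXi (w + s))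

/-- The Bernoulli operator function `sin(πB) · ξ(B + s)`; the product is formed before `B` is
evaluated. -/
noncomputable def sinXiB (s : ℂ) : ℂ :=
  bernoulliEval (fun w => Complex.sin (Real.pi * w) * entireXi (w + s))

/-- The theta series `ψ(x) = ∑_{n ≥ 1} e^(-n² π x)`, for `x > 0`. -/
noncomputable def thetaPsi (x : ℝ) : ℝ :=
  ∑' n : ℕ, Real.exp (-((n : ℝ) + 1) ^ 2 * Real.pi * x)

/-- The derivative `d/dx [x^(3/2) ψ'(x)]`. -/
noncomputable def thetaKernel (x : ℝ) : ℝ :=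
  deriv (fun y : ℝ => y ^ (3 / 2 : ℝ) * deriv thetaPsi y) x

/-- `φ(x) = d/dx [x^(3/2) ψ'(x)] · log x / (x^(1/2) - 1)`. -/
noncomputable def phiXi (x : ℝ) : ℝ :=
  thetaKernel x * (Real.log x / (Real.sqrt x - 1))

/-- `φ₁(x) = d/dx [x^(3/2) ψ'(x)] · 2π / (x^(1/2) + 1)`. -/
noncomputable def phiSinXi (x : ℝ) : ℝ :=
  thetaKernel x * (2 * Real.pi / (Real.sqrt x + 1))

/-! Everything rests on Riemann's formula `ξ(1/2 + a) = ∫ H(u) e^(au) du` over the real line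
(`entireXi_eq_integral`). Its kernel `H` = `xiKernel` is even, holomorphic in `|im w| < π/4`, and
decays faster than any exponential in smaller strips. Since `B = 1/2 + it`, Fubini turns averaging
over `t` into multiplication of the kernel by the Fourier–Laplace transform `χ` of the weight: `ξ(B
+ s) = ∫ H(u) χ(u) e^(su) du`.

On `B` the factor `sin(πB)` equals `cosh(πt)`, so the two weights are multiples of `sech²(πt)` and
`sech(πt)`. In logistic coordinates their transforms are beta integrals, and the reflection formula
gives `χ(u) = (u/2)/sinh(u/2)` and `χ(u) = π/(2 cosh(u/2))`. The exponential values of `B` follow at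
once, and the moments follow by differentiating a difference of two such integrals. Folding the line
at `0` and putting `x = e^(2u)` gives the integrals over `x > 1`, where the symmetry in `s` is
visible; positivity follows because each term of the theta series contributes positively to
`thetaKernel` for `x > 1`.

For the zeros, on `s = iτ` the value is the Fourier transform `F` of `G = Hχ`, which is real and
even. As `w → iπ/4` along the imaginary axis, `i e^(2w)` tends to `-1`, a cusp at which theta
vanishes to infinite order, so every derivative of `G` tends to `0`. If `F` had finitely many zeros,
it would have constant sign for `|ξ| ≥ T`. The derivatives of order `2m` of `G` at `iα` are, up to a
constant factor, the moments `∫ ξ^(2m) e^(-2παξ) F(ξ) dξ`. Their vanishing in the limit forces a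
positive multiple of `(T+1)^(2m)` to stay below a fixed multiple of `T^(2m)` for all `m`, which is
absurd (`IsStripDecaying.infinite_zeros_fourier`). -/

open Complex Filter Topology MeasureTheory Set FourierTransform

/-! ### Theta series and the positivity of the kernel -/

/-- The `k`-th derivative `∑ (-(n+1)²π)^k e^(-(n+1)²πz)` of the theta series, for `0 < re z`. -/
noncomputable def thetaSeries (k : ℕ) (z : ℂ) : ℂ :=
  ∑' n : ℕ, (-(((n : ℂ) + 1) ^ 2 * Real.pi)) ^ k * cexp (-(((n : ℂ) + 1) ^ 2 * Real.pi) * z)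

lemma one_le_sq_mul_pi (n : ℕ) : (1 : ℝ) ≤ ((n : ℝ) + 1) ^ 2 * Real.pi := by
  have h : (1 : ℝ) ≤ ((n : ℝ) + 1) ^ 2 := by nlinarith [(Nat.cast_nonneg n : (0 : ℝ) ≤ n)]
  nlinarith [Real.pi_gt_three]

/-- Since `(n+1)² ≥ n+1`, the terms are dominated by a polynomial times a geometric sequence. -/
lemma summable_thetaSeries_bound (k : ℕ) {c : ℝ} (hc : 0 < c) :
    Summable fun n : ℕ => (((n : ℝ) + 1) ^ 2 * Real.pi) ^ k *
      Real.exp (-(((n : ℝ) + 1) ^ 2 * Real.pi) * c) := by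
  have h1 : Summable fun n : ℕ => ((n + 1 : ℕ) : ℝ) ^ (2 * k) * Real.exp (-(Real.pi * c)) ^ (n + 1) := by
    have := summable_pow_mul_geometric_of_norm_lt_one (R := ℝ) (2 * k)
      (r := Real.exp (-(Real.pi * c))) (by
        rw [Real.norm_of_nonneg (Real.exp_pos _).le, Real.exp_lt_one_iff]
        have := Real.pi_pos
        nlinarith [mul_pos this hc])
    exact (summable_nat_add_iff 1).2 this
  refine Summable.of_nonneg_of_le (fun n => by positivity) (fun n => ?_)
    (h1.mul_left (Real.pi ^ k))
  rw [mul_pow, ← pow_mul, ← Real.exp_nat_mul, mul_comm _ (Real.pi ^ k), mul_assoc]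
  push_cast
  refine mul_le_mul_of_nonneg_left (mul_le_mul_of_nonneg_left (Real.exp_le_exp.2 ?_)
    (by positivity)) (by positivity)
  have h : ((n : ℝ) + 1) ≤ ((n : ℝ) + 1) ^ 2 := by nlinarith [(Nat.cast_nonneg n : (0 : ℝ) ≤ n)]
  have := mul_le_mul_of_nonneg_right h (mul_pos Real.pi_pos hc).le
  nlinarith

lemma norm_thetaSeries_term (k n : ℕ) (z : ℂ) :
    ‖(-(((n : ℂ) + 1) ^ 2 * Real.pi)) ^ k * cexp (-(((n : ℂ) + 1) ^ 2 * Real.pi) * z)‖ =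
      (((n : ℝ) + 1) ^ 2 * Real.pi) ^ k * Real.exp (-(((n : ℝ) + 1) ^ 2 * Real.pi) * z.re) := by
  have h : (-(((n : ℂ) + 1) ^ 2 * Real.pi)) = ((-(((n : ℝ) + 1) ^ 2 * Real.pi) : ℝ) : ℂ) := by
    push_cast; ring
  rw [h, norm_mul, norm_pow, norm_real, norm_exp, re_ofReal_mul, norm_neg,
    Real.norm_of_nonneg (by positivity)]

lemma norm_thetaSeries_term_le (k n : ℕ) {c : ℝ} {z : ℂ} (hz : c ≤ z.re) :
    ‖(-(((n : ℂ) + 1) ^ 2 * Real.pi)) ^ k * cexp (-(((n : ℂ) + 1) ^ 2 * Real.pi) * z)‖ ≤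
      (((n : ℝ) + 1) ^ 2 * Real.pi) ^ k * Real.exp (-(((n : ℝ) + 1) ^ 2 * Real.pi) * c) := by
  rw [norm_thetaSeries_term]
  refine mul_le_mul_of_nonneg_left (Real.exp_le_exp.2 ?_) (by positivity)
  nlinarith [mul_le_mul_of_nonneg_left hz (zero_le_one.trans (one_le_sq_mul_pi n))]

lemma hasSum_thetaSeries (k : ℕ) {z : ℂ} (hz : 0 < z.re) :
    HasSum (fun n : ℕ => (-(((n : ℂ) + 1) ^ 2 * Real.pi)) ^ k *
      cexp (-(((n : ℂ) + 1) ^ 2 * Real.pi) * z)) (thetaSeries k z) :=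
  (Summable.of_norm_bounded (summable_thetaSeries_bound k hz)
    (fun n => norm_thetaSeries_term_le k n le_rfl)).hasSum

lemma hasDerivAt_thetaSeries (k : ℕ) {z : ℂ} (hz : 0 < z.re) :
    HasDerivAt (thetaSeries k) (thetaSeries (k + 1) z) z := by
  have hc : 0 < z.re / 2 := by positivity
  have ho : IsOpen {y : ℂ | z.re / 2 < y.re} := isOpen_lt continuous_const continuous_re
  refine hasDerivAt_tsum_of_isPreconnected (summable_thetaSeries_bound (k + 1) hc) ho
    (convex_halfSpace_re_gt _).isPreconnected (fun n y hy => ?_)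
    (fun n y hy => norm_thetaSeries_term_le (k + 1) n (le_of_lt hy)) (y₀ := z) ?_
    (hasSum_thetaSeries k hz).summable ?_
  · have := (((hasDerivAt_id y).const_mul (-(((n : ℂ) + 1) ^ 2 * Real.pi))).cexp).const_mul
      ((-(((n : ℂ) + 1) ^ 2 * Real.pi)) ^ k)
    refine this.congr_deriv ?_
    simp only [id]; ring
  · show z.re / 2 < z.re; linarith
  · show z.re / 2 < z.re; linarith

/-- Every exponent `a = (n+1)²π` is at least `1`, so `e^(-ax) ≤ e^(-ac) e^(-(x-c))` for `x ≥ c`: one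
factor sums to a constant, the other gives the decay. -/
lemma norm_thetaSeries_le (k : ℕ) {c : ℝ} (hc : 0 < c) :
    ∃ C : ℝ, 0 ≤ C ∧ ∀ z : ℂ, c ≤ z.re → ‖thetaSeries k z‖ ≤ C * Real.exp (-z.re) := by
  refine ⟨Real.exp c * ∑' n : ℕ, (((n : ℝ) + 1) ^ 2 * Real.pi) ^ k *
      Real.exp (-(((n : ℝ) + 1) ^ 2 * Real.pi) * c),
      mul_nonneg (Real.exp_pos _).le (tsum_nonneg fun n => by positivity), fun z hz => ?_⟩
  rw [mul_right_comm, ← tsum_mul_left]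
  refine tsum_of_norm_bounded (((summable_thetaSeries_bound k hc).mul_left _).hasSum) fun n => ?_
  rw [norm_thetaSeries_term, mul_left_comm, ← Real.exp_add, ← Real.exp_add]
  gcongr
  nlinarith [one_le_sq_mul_pi n, mul_nonneg (sub_nonneg.2 (one_le_sq_mul_pi n)) (sub_nonneg.2 hz)]

/-- The real form of `thetaSeries`. -/
noncomputable def thetaSeriesReal (k : ℕ) (x : ℝ) : ℝ :=
  ∑' n : ℕ, (-(((n : ℝ) + 1) ^ 2 * Real.pi)) ^ k * Real.exp (-(((n : ℝ) + 1) ^ 2 * Real.pi) * x)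

lemma ofReal_thetaSeriesReal (k : ℕ) (x : ℝ) : (thetaSeriesReal k x : ℂ) = thetaSeries k x := by
  simp [thetaSeriesReal, thetaSeries, ofReal_tsum]

lemma hasSum_thetaSeriesReal (k : ℕ) {x : ℝ} (hx : 0 < x) :
    HasSum (fun n : ℕ => (-(((n : ℝ) + 1) ^ 2 * Real.pi)) ^ k *
      Real.exp (-(((n : ℝ) + 1) ^ 2 * Real.pi) * x)) (thetaSeriesReal k x) := by
  have := hasSum_thetaSeries k (z := x) (by simpa using hx)
  rw [← ofReal_thetaSeriesReal] at this
  rw [← Complex.hasSum_ofReal]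
  simpa using this

lemma hasDerivAt_thetaSeriesReal (k : ℕ) {x : ℝ} (hx : 0 < x) :
    HasDerivAt (thetaSeriesReal k) (thetaSeriesReal (k + 1) x) x := by
  have := (hasDerivAt_thetaSeries k (z := x) (by simpa using hx)).real_of_complex
  refine (this.congr_deriv ?_).congr_of_eventuallyEq (Eventually.of_forall fun y => ?_)
  · rw [← ofReal_thetaSeriesReal, ofReal_re]
  · simp only [← ofReal_thetaSeriesReal, ofReal_re]

lemma thetaPsi_eq : thetaPsi = thetaSeriesReal 0 := by
  ext x
  simp [thetaPsi, thetaSeriesReal, neg_mul]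

lemma thetaKernel_eq {x : ℝ} (hx : 0 < x) :
    thetaKernel x = 3 / 2 * x ^ (1 / 2 : ℝ) * thetaSeriesReal 1 x +
      x ^ (3 / 2 : ℝ) * thetaSeriesReal 2 x := by
  have h : (fun y : ℝ => y ^ (3 / 2 : ℝ) * deriv thetaPsi y) =ᶠ[𝓝 x]
      fun y => y ^ (3 / 2 : ℝ) * thetaSeriesReal 1 y := by
    filter_upwards [lt_mem_nhds hx] with y hy
    rw [thetaPsi_eq, (hasDerivAt_thetaSeriesReal 0 hy).deriv]
  rw [thetaKernel, h.deriv_eq]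
  have h1 := (Real.hasDerivAt_rpow_const (x := x) (p := 3 / 2) (Or.inl hx.ne')).mul
    (hasDerivAt_thetaSeriesReal 1 hx)
  refine h1.deriv.trans ?_
  norm_num

/-- Up to the factor `x^(1/2)`, the term with `a = (n+1)²π` is `a e^(-ax) (ax - 3/2)`, which is
positive because `a > 3` and `x > 1`. -/
lemma thetaKernel_pos {x : ℝ} (hx : 1 < x) : 0 < thetaKernel x := by
  have hx0 : 0 < x := by linarith
  have h := ((hasSum_thetaSeriesReal 1 hx0).mul_left (3 / 2)).add
    ((hasSum_thetaSeriesReal 2 hx0).mul_left x)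
  have hpos : ∀ n : ℕ, 0 < 3 / 2 * ((-(((n : ℝ) + 1) ^ 2 * Real.pi)) ^ 1 *
      Real.exp (-(((n : ℝ) + 1) ^ 2 * Real.pi) * x)) + x * ((-(((n : ℝ) + 1) ^ 2 * Real.pi)) ^ 2 *
      Real.exp (-(((n : ℝ) + 1) ^ 2 * Real.pi) * x)) := by
    intro n
    have h3 : (3 : ℝ) < ((n : ℝ) + 1) ^ 2 * Real.pi := by
      have h : (1 : ℝ) ≤ ((n : ℝ) + 1) ^ 2 := by nlinarith [(Nat.cast_nonneg n : (0 : ℝ) ≤ n)]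
      nlinarith [Real.pi_gt_three]
    set a := ((n : ℝ) + 1) ^ 2 * Real.pi
    have he := Real.exp_pos (-a * x)
    have : 3 / 2 * ((-a) ^ 1 * Real.exp (-a * x)) + x * ((-a) ^ 2 * Real.exp (-a * x)) =
        a * Real.exp (-a * x) * (a * x - 3 / 2) := by ring
    rw [this]
    have : 3 / 2 < a * x := by nlinarith
    have := sub_pos.2 this
    positivity
  have hs : 0 < 3 / 2 * thetaSeriesReal 1 x + x * thetaSeriesReal 2 x := by
    rw [← h.tsum_eq]
    exact h.summable.tsum_pos (fun n => (hpos n).le) 0 (hpos 0)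
  rw [thetaKernel_eq hx0, show (3 / 2 : ℝ) = 1 / 2 + 1 by norm_num, Real.rpow_add hx0, Real.rpow_one]
  have := Real.rpow_pos_of_pos hx0 (1 / 2)
  nlinarith [mul_pos this hs]

/-! ### Contour shifts and Fourier transforms in a strip -/

lemma integrable_exp_neg_mul_abs {a : ℝ} (ha : 0 < a) :
    Integrable fun x : ℝ => Real.exp (-a * |x|) := by
  have h0 : IntegrableOn (fun x : ℝ => Real.exp (-a * |x|)) (Ioi 0) :=
    (integrableOn_exp_mul_Ioi (neg_lt_zero.2 ha) 0).congr_fun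
      (fun x hx => by simp only [abs_of_pos (mem_Ioi.1 hx)]) measurableSet_Ioi
  have h1 : IntegrableOn (fun x : ℝ => Real.exp (-a * |x|)) (Iic 0) :=
    (integrableOn_exp_mul_Iic ha 0).congr_fun
      (fun x hx => by simp only [abs_of_nonpos (mem_Iic.1 hx)]; ring_nf) measurableSet_Iic
  rw [← integrableOn_univ, ← Iic_union_Ioi (a := (0 : ℝ))]
  exact h1.union h0

/-- Shifting a line of integration in a strip in which the integrand decays exponentially. -/
lemma integral_horizontal_shift {f : ℂ → ℂ} {a b C c : ℝ} (hc : 0 < c)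
    (hf : DifferentiableOn ℂ f {z | z.im ∈ uIcc a b})
    (hb : ∀ z : ℂ, z.im ∈ uIcc a b → ‖f z‖ ≤ C * Real.exp (-c * |z.re|)) :
    ∫ x : ℝ, f (x + a * I) = ∫ x : ℝ, f (x + b * I) := by
  have hint : ∀ t ∈ uIcc a b, Integrable fun x : ℝ => f (x + t * I) := by
    intro t ht
    have hcont : Continuous fun x : ℝ => f (x + t * I) := by
      refine hf.continuousOn.comp_continuous (by fun_prop) fun x => ?_
      simpa using ht
    refine ((integrable_exp_neg_mul_abs hc).const_mul C).mono' hcont.aestronglyMeasurable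
      (Eventually.of_forall fun x => ?_)
    simpa using hb (x + t * I) (by simpa using ht)
  have hlim : ∀ t ∈ uIcc a b, Tendsto (fun R : ℝ => ∫ x in (-R)..R, f (x + t * I)) atTop
      (𝓝 (∫ x : ℝ, f (x + t * I))) := fun t ht =>
    intervalIntegral_tendsto_integral (hint t ht) tendsto_neg_atTop_atBot tendsto_id
  have hexp : Tendsto (fun R : ℝ => C * Real.exp (-c * |R|) * |b - a|) atTop (𝓝 0) := by
    have : Tendsto (fun R : ℝ => Real.exp (-c * |R|)) atTop (𝓝 0) := by
      refine Real.tendsto_exp_atBot.comp ?_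
      exact (tendsto_abs_atTop_atTop).const_mul_atTop_of_neg (neg_lt_zero.2 hc)
    simpa using (this.const_mul C).mul_const |b - a|
  have hside : ∀ σ : ℝ, |σ| = 1 → Tendsto (fun R : ℝ => ∫ y in a..b, f ((σ * R : ℝ) + y * I)) atTop
      (𝓝 0) := by
    intro σ hσ
    refine squeeze_zero_norm (fun R => ?_) hexp
    refine intervalIntegral.norm_integral_le_of_norm_le_const fun y hy => ?_
    have := hb ((σ * R : ℝ) + y * I) (by simpa using uIoc_subset_uIcc hy)
    have h2 : (((σ * R : ℝ) : ℂ) + y * I).re = σ * R := by simp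
    rwa [h2, abs_mul, hσ, one_mul] at this
  -- Cauchy's theorem on the rectangle with vertical sides at `±R`; these sides vanish as `R → ∞`.
  have key : ∀ R : ℝ, (∫ x in (-R)..R, f (x + a * I)) - (∫ x in (-R)..R, f (x + b * I)) =
      I * (∫ y in a..b, f (((-1) * R : ℝ) + y * I)) - I * ∫ y in a..b, f ((1 * R : ℝ) + y * I) := by
    intro R
    have := integral_boundary_rect_eq_zero_of_differentiableOn f ((-R : ℝ) + a * I) ((R : ℝ) + b * I)
      (hf.mono fun z hz => by simpa using (mem_reProdIm.1 hz).2)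
    simp only [add_re, ofReal_re, mul_re, I_re, mul_zero, ofReal_im, I_im, mul_one, sub_self,
      add_zero, add_im, mul_im, zero_add, smul_eq_mul] at this
    rw [neg_one_mul, one_mul]
    linear_combination this
  have h1 := (hlim a left_mem_uIcc).sub (hlim b right_mem_uIcc)
  have h2 := ((hside (-1) (by simp)).const_mul I).sub ((hside 1 (by simp)).const_mul I)
  simp only [key] at h1
  have := tendsto_nhds_unique h1 h2
  simpa [sub_eq_zero] using this

section Strip

variable {G : ℂ → ℂ} {β : ℝ}

/-- `G` is holomorphic in the strip `|im w| < β`, with exponential decay in smaller strips. -/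
structure IsStripDecaying (G : ℂ → ℂ) (β : ℝ) : Prop where
  differentiableOn : DifferentiableOn ℂ G {w | |w.im| < β}
  decay : ∀ α < β, ∃ C : ℝ, ∀ w : ℂ, |w.im| ≤ α → ‖G w‖ ≤ C * Real.exp (-|w.re|)

namespace IsStripDecaying

lemma isOpen_strip (β : ℝ) : IsOpen {w : ℂ | |w.im| < β} :=
  isOpen_lt (by fun_prop) continuous_const

lemma continuous_line (h : IsStripDecaying G β) {α : ℝ} (hα : |α| < β) :
    Continuous fun u : ℝ => G (u + α * I) :=
  h.differentiableOn.continuousOn.comp_continuous (by fun_prop) fun x => by simpa using hα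

lemma integrable_line (h : IsStripDecaying G β) {α : ℝ} (hα : |α| < β) :
    Integrable fun u : ℝ => G (u + α * I) := by
  obtain ⟨C, hC⟩ := h.decay |α| hα
  refine ((integrable_exp_neg_mul_abs one_pos).const_mul C).mono'
    (h.continuous_line hα).aestronglyMeasurable (Eventually.of_forall fun x => ?_)
  simpa using hC (x + α * I) (by simp)

/-- Shift the line of integration of `e^(-2πiξz) G(z)` from height `0` to height `α`. -/
lemma fourier_line (h : IsStripDecaying G β) {α : ℝ} (hα : |α| < β) (ξ : ℝ) :
    𝓕 (fun u : ℝ => G (u + α * I)) ξ =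
      Real.exp (-2 * Real.pi * α * ξ) * 𝓕 (fun u : ℝ => G u) ξ := by
  obtain ⟨C, hC⟩ := h.decay |α| hα
  have hs : {z : ℂ | z.im ∈ uIcc 0 α} ⊆ {z | |z.im| ≤ |α|} := fun z hz => by
    simpa using abs_sub_left_of_mem_uIcc hz
  have := integral_horizontal_shift (f := fun z => cexp (-2 * Real.pi * ξ * I * z) * G z)
    (a := 0) (b := α) (C := Real.exp (2 * Real.pi * |ξ| * |α|) * C) one_pos
    (((by fun_prop : Differentiable ℂ fun z : ℂ => cexp (-2 * Real.pi * ξ * I * z)).differentiableOn).mul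
      (h.differentiableOn.mono fun z hz => lt_of_le_of_lt (hs hz) hα)) (fun z hz => by
      rw [norm_mul, mul_assoc (Real.exp _), norm_exp]
      refine mul_le_mul (Real.exp_le_exp.2 ?_) (by simpa using hC z (hs hz)) (norm_nonneg _)
        (Real.exp_pos _).le
      have h1 : (-2 * Real.pi * ξ * I * z).re = 2 * Real.pi * (ξ * z.im) := by
        rw [show (-2 * Real.pi * ξ * I * z) = ((-2 * Real.pi * ξ : ℝ) : ℂ) * (I * z) by push_cast; ring]
        rw [re_ofReal_mul]; simp; ring
      rw [h1, mul_assoc (2 * Real.pi)]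
      refine mul_le_mul_of_nonneg_left ?_ (by positivity)
      calc ξ * z.im ≤ |ξ * z.im| := le_abs_self _
        _ = |ξ| * |z.im| := abs_mul _ _
        _ ≤ |ξ| * |α| := mul_le_mul_of_nonneg_left (hs hz) (abs_nonneg _))
  simp only [Real.fourier_real_eq_integral_exp_smul, smul_eq_mul]
  have h0 : ∫ v : ℝ, cexp (((-2 * Real.pi * v * ξ : ℝ) : ℂ) * I) * G v =
      ∫ x : ℝ, cexp (-2 * Real.pi * ξ * I * (x + α * I)) * G (x + α * I) := by
    rw [← this]
    congr 1
    ext v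
    push_cast
    congr 2
    · ring
    · ring
  rw [h0, ← integral_const_mul]
  congr 1
  ext v
  rw [← mul_assoc, ofReal_exp, ← Complex.exp_add]
  congr 2
  push_cast
  linear_combination (2 * Real.pi * ξ * α : ℂ) * I_sq

/-- The trivial bound on the line at height `γ` costs a factor `e^(2πγξ)`; taking `γ = -α` for `ξ ≥
0` and `γ = α` for `ξ ≤ 0` makes it a decay. -/
lemma norm_fourier_le (h : IsStripDecaying G β) {α : ℝ} (h0 : 0 ≤ α) (hα : α < β) :
    ∃ C : ℝ, ∀ ξ : ℝ, ‖𝓕 (fun u : ℝ => G u) ξ‖ ≤ C * Real.exp (-(2 * Real.pi * α) * |ξ|) := by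
  have hbd : ∀ γ : ℝ, |γ| < β → ∀ ξ : ℝ, ‖𝓕 (fun u : ℝ => G u) ξ‖ ≤
      (∫ u : ℝ, ‖G (u + γ * I)‖) * Real.exp (2 * Real.pi * γ * ξ) := by
    intro γ hγ ξ
    have h1 : ‖𝓕 (fun u : ℝ => G (u + γ * I)) ξ‖ ≤ ∫ u : ℝ, ‖G (u + γ * I)‖ := by
      rw [Real.fourier_real_eq_integral_exp_smul]
      refine (norm_integral_le_integral_norm _).trans_eq ?_
      congr 1
      ext v
      rw [norm_smul, norm_exp_ofReal_mul_I, one_mul]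
    rw [h.fourier_line hγ, norm_mul, norm_real, Real.norm_of_nonneg (Real.exp_pos _).le] at h1
    calc ‖𝓕 (fun u : ℝ => G u) ξ‖
        = Real.exp (2 * Real.pi * γ * ξ) *
          (Real.exp (-2 * Real.pi * γ * ξ) * ‖𝓕 (fun u : ℝ => G u) ξ‖) := by
          rw [← mul_assoc, ← Real.exp_add]; ring_nf; simp
      _ ≤ Real.exp (2 * Real.pi * γ * ξ) * ∫ u : ℝ, ‖G (u + γ * I)‖ := by gcongr
      _ = _ := mul_comm _ _
  refine ⟨max (∫ u : ℝ, ‖G (u + (α : ℝ) * I)‖) (∫ u : ℝ, ‖G (u + (-α : ℝ) * I)‖), fun ξ => ?_⟩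
  rcases le_total 0 ξ with hξ | hξ
  · refine (hbd (-α) (by rwa [abs_neg, abs_of_nonneg h0]) ξ).trans ?_
    rw [abs_of_nonneg hξ]
    refine mul_le_mul (le_max_right _ _) (le_of_eq (by ring_nf)) (Real.exp_pos _).le
      (le_max_of_le_left (integral_nonneg fun _ => norm_nonneg _))
  · refine (hbd α (by rwa [abs_of_nonneg h0]) ξ).trans ?_
    rw [abs_of_nonpos hξ]
    refine mul_le_mul (le_max_left _ _) (le_of_eq (by ring_nf)) (Real.exp_pos _).le
      (le_max_of_le_left (integral_nonneg fun _ => norm_nonneg _))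

lemma continuous_fourier (h : IsStripDecaying G β) (hβ : 0 < β) :
    Continuous (𝓕 (fun u : ℝ => G u)) := by
  have : Integrable fun u : ℝ => G u := by simpa using h.integrable_line (α := 0) (by simpa)
  exact VectorFourier.fourierIntegral_continuous Real.continuous_fourierChar
    (by exact continuous_inner) this

/-- The `n`-th moment kernel: the integrand of the `n`-th derivative of the inverse transform. -/
noncomputable def momentKernel (G : ℂ → ℂ) (n : ℕ) (w : ℂ) (ξ : ℝ) : ℂ :=
  (2 * Real.pi * I * ξ) ^ n * cexp (2 * Real.pi * I * ξ * w) * 𝓕 (fun u : ℝ => G u) ξ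

lemma norm_momentKernel_le (h : IsStripDecaying G β) {α : ℝ} (h0 : 0 ≤ α) (hα : α < β) (n : ℕ) :
    ∃ g : ℝ → ℝ, Integrable g ∧ ∀ w : ℂ, |w.im| ≤ α → ∀ ξ : ℝ, ‖momentKernel G n w ξ‖ ≤ g ξ := by
  obtain ⟨γ, hαγ, hγ⟩ := exists_between hα
  obtain ⟨C, hC⟩ := h.norm_fourier_le (h0.trans hαγ.le) hγ
  -- The transform decays at rate `2πγ` and the exponential grows at rate at most `2πα`. Half of the
  -- gap `2π(γ - α)` absorbs the power of `ξ`; the other half is kept for integrability.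
  have hd : 0 < Real.pi * (γ - α) := mul_pos Real.pi_pos (sub_pos.2 hαγ)
  refine ⟨fun ξ => (n.factorial * (2 / (γ - α)) ^ n * C) * Real.exp (-(Real.pi * (γ - α)) * |ξ|),
    (integrable_exp_neg_mul_abs hd).const_mul _, fun w hw ξ => ?_⟩
  have h1 : ‖(2 * Real.pi * I * ξ : ℂ) ^ n‖ = (2 * Real.pi * |ξ|) ^ n := by
    simp [abs_of_pos Real.pi_pos]
  have h2 : ‖cexp (2 * Real.pi * I * ξ * w)‖ ≤ Real.exp (2 * Real.pi * α * |ξ|) := by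
    rw [norm_exp]
    refine Real.exp_le_exp.2 ?_
    have : (2 * Real.pi * I * ξ * w).re = 2 * Real.pi * (-(ξ * w.im)) := by
      rw [show (2 * Real.pi * I * ξ * w) = ((2 * Real.pi * ξ : ℝ) : ℂ) * (I * w) by push_cast; ring]
      rw [re_ofReal_mul]; simp; ring
    rw [this, mul_assoc (2 * Real.pi)]
    refine mul_le_mul_of_nonneg_left ?_ (by positivity)
    calc -(ξ * w.im) ≤ |ξ * w.im| := neg_le_abs _
      _ = |w.im| * |ξ| := by rw [abs_mul, mul_comm]
      _ ≤ α * |ξ| := by gcongr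
  have h3 : (2 * Real.pi * |ξ|) ^ n ≤
      n.factorial * (2 / (γ - α)) ^ n * Real.exp (Real.pi * (γ - α) * |ξ|) := by
    have := Real.pow_div_factorial_le_exp (Real.pi * (γ - α) * |ξ|) (by positivity) n
    rw [div_le_iff₀ (by positivity)] at this
    have h4 : (2 * Real.pi * |ξ|) ^ n = (2 / (γ - α)) ^ n * (Real.pi * (γ - α) * |ξ|) ^ n := by
      rw [← mul_pow]
      congr 1
      have := (sub_pos.2 hαγ).ne'
      field_simp
    rw [h4]
    calc _ ≤ (2 / (γ - α)) ^ n * (Real.exp (Real.pi * (γ - α) * |ξ|) * n.factorial) := by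
          have := (sub_pos.2 hαγ).le
          gcongr
      _ = _ := by ring
  have hC0 : 0 ≤ C := by simpa using (norm_nonneg _).trans (hC 0)
  rw [momentKernel, norm_mul, norm_mul, h1]
  have := sub_pos.2 hαγ
  calc _ ≤ (n.factorial * (2 / (γ - α)) ^ n * Real.exp (Real.pi * (γ - α) * |ξ|)) *
      Real.exp (2 * Real.pi * α * |ξ|) * (C * Real.exp (-(2 * Real.pi * γ) * |ξ|)) := by
        gcongr
        exact hC ξ
    _ = (n.factorial * (2 / (γ - α)) ^ n * C) * (Real.exp (Real.pi * (γ - α) * |ξ|) *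
      Real.exp (2 * Real.pi * α * |ξ|) * Real.exp (-(2 * Real.pi * γ) * |ξ|)) := by ring
    _ = _ := by
      rw [← Real.exp_add, ← Real.exp_add]
      ring_nf

lemma continuous_momentKernel (h : IsStripDecaying G β) (hβ : 0 < β) (n : ℕ) (w : ℂ) :
    Continuous (momentKernel G n w) := by
  have := h.continuous_fourier hβ
  unfold momentKernel
  fun_prop

lemma integrable_momentKernel (h : IsStripDecaying G β) (n : ℕ) {w : ℂ}
    (hw : |w.im| < β) : Integrable (momentKernel G n w) := by
  obtain ⟨g, hg, hb⟩ := h.norm_momentKernel_le (abs_nonneg _) hw n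
  exact hg.mono' (h.continuous_momentKernel ((abs_nonneg _).trans_lt hw) n w).aestronglyMeasurable
    (Eventually.of_forall (hb w le_rfl))

lemma hasDerivAt_integral_momentKernel (h : IsStripDecaying G β) (n : ℕ) {w : ℂ}
    (hw : |w.im| < β) : HasDerivAt (fun z => ∫ ξ, momentKernel G n z ξ)
      (∫ ξ, momentKernel G (n + 1) w ξ) w := by
  obtain ⟨α, hα, hαβ⟩ := exists_between hw
  obtain ⟨g, hg, hb⟩ := h.norm_momentKernel_le ((abs_nonneg _).trans hα.le) hαβ (n + 1)
  have hβ := (abs_nonneg _).trans_lt hw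
  refine (hasDerivAt_integral_of_dominated_loc_of_deriv_le
    ((isOpen_strip α).mem_nhds hα) (Eventually.of_forall fun z =>
      (h.continuous_momentKernel hβ n z).aestronglyMeasurable) (h.integrable_momentKernel n hw)
    (h.continuous_momentKernel hβ (n + 1) w).aestronglyMeasurable
    (Eventually.of_forall fun ξ z hz => hb z (le_of_lt hz) ξ) hg
    (Eventually.of_forall fun ξ z _ => ?_)).2
  unfold momentKernel
  have := (((((hasDerivAt_id z).const_mul (2 * Real.pi * I * ξ)).cexp).const_mul
    ((2 * Real.pi * I * ξ : ℂ) ^ n)).mul_const (𝓕 (fun u : ℝ => G u) ξ))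
  refine this.congr_deriv ?_
  simp only [id]
  ring

/-- Fourier inversion on all lines of the strip. -/
lemma eq_integral_momentKernel (h : IsStripDecaying G β) {w : ℂ} (hw : |w.im| < β) :
    G w = ∫ ξ, momentKernel G 0 w ξ := by
  have hfun : 𝓕 (fun u : ℝ => G (u + w.im * I)) =
      fun ξ : ℝ => Real.exp (-2 * Real.pi * w.im * ξ) * 𝓕 (fun u : ℝ => G u) ξ :=
    funext (h.fourier_line hw)
  have hker : ∀ x : ℝ, momentKernel G 0 (x + w.im * I) = fun ξ : ℝ =>
      cexp (((2 * Real.pi * (ξ * x) : ℝ) : ℂ) * I) •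
        ((Real.exp (-2 * Real.pi * w.im * ξ) : ℂ) * 𝓕 (fun u : ℝ => G u) ξ) := by
    intro x
    ext ξ
    rw [momentKernel, pow_zero, one_mul, smul_eq_mul, ← mul_assoc, ofReal_exp, ← Complex.exp_add]
    congr 2
    push_cast
    linear_combination (2 * Real.pi * ξ * w.im : ℂ) * I_sq
  have hint : Integrable (𝓕 (fun u : ℝ => G (u + w.im * I))) := by
    have h0 := h.integrable_momentKernel 0 (w := (0 : ℝ) + w.im * I) (by simpa using hw)
    rw [hker] at h0
    rw [hfun]
    simpa using h0
  have := (h.integrable_line hw).fourierInv_fourier_eq hint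
    (h.continuous_line hw).continuousAt (v := w.re)
  rw [Real.fourierInv_eq', hfun, re_add_im] at this
  have hw' := hker w.re
  rw [re_add_im] at hw'
  rw [← this, hw']
  congr 1
  ext ξ
  simp [mul_comm]

lemma iteratedDeriv_eq (h : IsStripDecaying G β) (n : ℕ) :
    ∀ w : ℂ, |w.im| < β → iteratedDeriv n G w = ∫ ξ, momentKernel G n w ξ := by
  induction n with
  | zero => intro w hw; simpa using h.eq_integral_momentKernel hw
  | succ n ih =>
    intro w hw
    rw [iteratedDeriv_succ, ← (h.hasDerivAt_integral_momentKernel n hw).deriv]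
    refine EventuallyEq.deriv_eq ?_
    filter_upwards [(isOpen_strip β).mem_nhds hw] with z hz using ih z hz

end IsStripDecaying

end Strip

/-! ### The Hardy–Pólya criterion for infinitely many real zeros -/

/-- A continuous even real function with finitely many zeros has a constant sign near infinity. -/
lemma exists_sign_of_finite_zeros {r : ℝ → ℝ} (hr : Continuous r) (heven : ∀ x, r (-x) = r x)
    (hfin : {x | r x = 0}.Finite) :
    ∃ T : ℝ, 0 < T ∧ ∃ ε : ℝ, (ε = 1 ∨ ε = -1) ∧ ∀ x, T ≤ |x| → 0 < ε * r x := by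
  obtain ⟨M, hM⟩ := hfin.isBounded.subset_closedBall 0
  have hne : ∀ x ∈ Ici (max M 0 + 1), r x ≠ 0 := by
    intro x hx h0
    have h1 : ‖x‖ ≤ M := by simpa using hM h0
    have h2 := mem_Ici.1 hx
    have := le_max_left M 0
    have := (le_abs_self x).trans h1
    linarith
  refine ⟨max M 0 + 1, by positivity, ?_⟩
  have hconst : (∀ x ∈ Ici (max M 0 + 1), 0 < r x) ∨ ∀ x ∈ Ici (max M 0 + 1), r x < 0 := by
    by_contra! hcon
    obtain ⟨⟨x, hx, hrx⟩, y, hy, hry⟩ := hcon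
    obtain ⟨z, hz, hz0⟩ := isPreconnected_Ici.intermediate_value hx hy hr.continuousOn ⟨hrx, hry⟩
    exact hne z hz hz0
  have habs : ∀ x, r |x| = r x := fun x => by
    rcases abs_choice x with h | h <;> rw [h]
    exact heven x
  rcases hconst with h | h
  · exact ⟨1, Or.inl rfl, fun x hx => by rw [one_mul, ← habs]; exact h _ hx⟩
  · exact ⟨-1, Or.inr rfl, fun x hx => by have := h _ hx; rw [habs] at this; linarith⟩

/-- The integrand is bounded below pointwise: on `[-T, T]` by its worst possible size, on `[-(T+2),
-(T+1)]` by using `e^(-αx) ≥ 1` for negative `x`, and elsewhere by `0`. The bound does not involve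
`α`, so it survives a limit in `α`. -/
lemma moment_lower_bound {p : ℝ → ℝ} {T α β : ℝ} (hp : Continuous p) (hT : 0 < T)
    (hpos : ∀ x, T ≤ |x| → 0 < p x) (hα : 0 ≤ α) (hαβ : α ≤ β) (m : ℕ)
    (hint : Integrable fun x : ℝ => x ^ (2 * m) * Real.exp (-α * x) * p x) :
    (T + 1) ^ (2 * m) * (∫ x in Icc (-(T + 2)) (-(T + 1)), p x) -
      T ^ (2 * m) * (∫ x in Icc (-T) T, Real.exp (β * T) * |p x|) ≤
      ∫ x : ℝ, x ^ (2 * m) * Real.exp (-α * x) * p x := by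
  have hi1 : IntegrableOn (fun x => (T + 1) ^ (2 * m) * p x) (Icc (-(T + 2)) (-(T + 1))) :=
    (by fun_prop : Continuous fun x => (T + 1) ^ (2 * m) * p x).continuousOn.integrableOn_Icc
  have hi2 : IntegrableOn (fun x => T ^ (2 * m) * (Real.exp (β * T) * |p x|)) (Icc (-T) T) :=
    (by fun_prop : Continuous fun x => T ^ (2 * m) * (Real.exp (β * T) * |p x|)).continuousOn.integrableOn_Icc
  rw [← integral_const_mul, ← integral_const_mul, ← integral_indicator measurableSet_Icc,
    ← integral_indicator measurableSet_Icc, ← integral_sub (hi1.integrable_indicator measurableSet_Icc)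
      (hi2.integrable_indicator measurableSet_Icc)]
  refine integral_mono ((hi1.integrable_indicator measurableSet_Icc).sub
    (hi2.integrable_indicator measurableSet_Icc)) hint fun x => ?_
  have heven : Even (2 * m) := even_two_mul m
  have hx0 : 0 ≤ x ^ (2 * m) := heven.pow_nonneg x
  have he := Real.exp_pos (-α * x)
  by_cases h1 : x ∈ Icc (-T) T
  · have h2 : x ∉ Icc (-(T + 2)) (-(T + 1)) := fun h => by linarith [h.2, h1.1]
    rw [indicator_of_mem h1, indicator_of_notMem h2, zero_sub]
    have habs : |x| ≤ T := abs_le.2 h1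
    have hle : x ^ (2 * m) * Real.exp (-α * x) * |p x| ≤
        T ^ (2 * m) * (Real.exp (β * T) * |p x|) := by
      rw [← mul_assoc, ← heven.pow_abs]
      have : -α * x ≤ β * T := by
        calc -α * x ≤ α * |x| := by nlinarith [neg_abs_le x]
          _ ≤ β * T := by gcongr; linarith
      gcongr
    have : -(x ^ (2 * m) * Real.exp (-α * x) * |p x|) ≤ x ^ (2 * m) * Real.exp (-α * x) * p x := by
      rw [← mul_neg]
      exact mul_le_mul_of_nonneg_left (neg_abs_le _) (by positivity)
    linarith
  · have hTx : T ≤ |x| := by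
      by_contra! h
      exact h1 (abs_le.1 h.le)
    have hpx := hpos x hTx
    rw [indicator_of_notMem h1, sub_zero]
    by_cases h2 : x ∈ Icc (-(T + 2)) (-(T + 1))
    · rw [indicator_of_mem h2]
      have hx : T + 1 ≤ |x| := by rw [abs_of_nonpos (by linarith [h2.2])]; linarith [h2.2]
      rw [← heven.pow_abs x]
      have h3 : 1 ≤ Real.exp (-α * x) := Real.one_le_exp (by nlinarith [h2.2])
      have h4 : (T + 1) ^ (2 * m) ≤ |x| ^ (2 * m) := by gcongr
      have h5 : (T + 1) ^ (2 * m) ≤ |x| ^ (2 * m) * Real.exp (-α * x) :=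
        h4.trans (le_mul_of_one_le_right (by positivity) h3)
      gcongr
    · rw [indicator_of_notMem h2]
      positivity

/-- **Hardy's theorem in Pólya's form**: if `G` is real and even on the real line, holomorphic and
decaying in a strip, and if all its derivatives tend to `0` at the boundary point `iβ`, then the
Fourier transform of `G` has infinitely many real zeros. -/
theorem IsStripDecaying.infinite_zeros_fourier {G : ℂ → ℂ} {β : ℝ} (h : IsStripDecaying G β)
    (hβ : 0 < β) (heven : ∀ u : ℝ, G (-u) = G u) (hreal : ∀ u : ℝ, (starRingEnd ℂ) (G u) = G u)
    (hflat : ∀ n : ℕ, Tendsto (fun α : ℝ => iteratedDeriv n G (α * I)) (𝓝[<] β) (𝓝 0)) :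
    {ξ : ℝ | 𝓕 (fun u : ℝ => G u) ξ = 0}.Infinite := by
  intro hfin
  set F : ℝ → ℂ := 𝓕 (fun u : ℝ => G u) with hF
  have hFcont : Continuous F := h.continuous_fourier hβ
  have hFeven : ∀ ξ, F (-ξ) = F ξ := by
    intro ξ
    simp only [hF, Real.fourier_real_eq_integral_exp_smul]
    rw [← integral_neg_eq_self]
    congr 1
    ext v
    rw [ofReal_neg, heven]
    congr 3
    push_cast
    ring
  have hFreal : ∀ ξ, F ξ = ((F ξ).re : ℂ) := by
    intro ξ
    refine (conj_eq_iff_re.1 ?_).symm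
    refine (?_ : _ = F (-ξ)).trans (hFeven ξ)
    simp only [hF, Real.fourier_real_eq_integral_exp_smul]
    rw [← integral_conj]
    congr 1
    ext v
    rw [smul_eq_mul, map_mul, hreal, ← exp_conj, map_mul, conj_ofReal, conj_I]
    congr 2
    push_cast
    ring
  obtain ⟨T, hT, ε, hε, hpos⟩ := exists_sign_of_finite_zeros (r := fun ξ => (F ξ).re)
    (continuous_re.comp hFcont) (fun x => by simp only [hFeven]) (by
      convert! hfin using 3 with x
      rw [hFreal x]; simp)
  set p : ℝ → ℝ := fun ξ => ε * (F ξ).re with hp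
  have hpcont : Continuous p := continuous_const.mul (continuous_re.comp hFcont)
  -- At purely imaginary points, even derivatives have real integrands of constant sign for large
  -- `|ξ|`; the sign `ε` is moved into the constant by `ε² = 1`.
  have hker : ∀ (m : ℕ) (α : ℝ), momentKernel G (2 * m) (α * I) = fun ξ =>
      (((-1) ^ m * (2 * Real.pi) ^ (2 * m) * ε : ℝ) : ℂ) *
        ((ξ ^ (2 * m) * Real.exp (-(2 * Real.pi * α) * ξ) * p ξ : ℝ) : ℂ) := by
    intro m α
    ext ξ
    have hεε : (ε : ℂ) * ε = 1 := by rcases hε with h | h <;> simp [h]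
    rw [momentKernel, ← hF]
    have h1 : (2 * Real.pi * I * ξ : ℂ) ^ (2 * m) = (-1) ^ m * (2 * Real.pi) ^ (2 * m) * ξ ^ (2 * m) := by
      rw [mul_pow, mul_pow, pow_mul I, I_sq]; ring
    have h2 : (2 * Real.pi * I * ξ * (α * I) : ℂ) = -(2 * Real.pi * α) * ξ := by
      linear_combination (2 * Real.pi * ξ * α : ℂ) * I_sq
    rw [h1, h2, hFreal ξ]
    push_cast [hp]
    linear_combination (-((-1) ^ m * (2 * Real.pi) ^ (2 * m) * ξ ^ (2 * m) *
      cexp (-(2 * Real.pi * α) * ξ) * (F ξ).re : ℂ)) * hεε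
  have hcoef : ∀ m : ℕ, ((-1) ^ m * (2 * Real.pi) ^ (2 * m) * ε : ℝ) ≠ 0 := by
    intro m
    have : ε ≠ 0 := by rcases hε with h | h <;> simp [h]
    have := Real.pi_ne_zero
    positivity
  have hbound : ∀ m : ℕ, (T + 1) ^ (2 * m) * (∫ x in Icc (-(T + 2)) (-(T + 1)), p x) ≤
      T ^ (2 * m) * (∫ x in Icc (-T) T, Real.exp (2 * Real.pi * β * T) * |p x|) := by
    intro m
    set a : ℝ := (-1) ^ m * (2 * Real.pi) ^ (2 * m) * ε with ha
    have hlim : Tendsto (fun α : ℝ =>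
        ∫ x : ℝ, x ^ (2 * m) * Real.exp (-(2 * Real.pi * α) * x) * p x) (𝓝[<] β) (𝓝 0) := by
      have h1 : Tendsto (fun α : ℝ => (a : ℂ)⁻¹ * iteratedDeriv (2 * m) G (α * I)) (𝓝[<] β) (𝓝 0) := by
        simpa using (hflat (2 * m)).const_mul (a : ℂ)⁻¹
      have h2 := (continuous_re.tendsto _).comp h1
      rw [zero_re] at h2
      refine h2.congr' ?_
      filter_upwards [Ioo_mem_nhdsLT hβ] with α hα
      have hαβ : |((α : ℂ) * I).im| < β := by simpa [abs_of_pos hα.1] using hα.2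
      rw [Function.comp_apply, h.iteratedDeriv_eq _ _ hαβ, hker, integral_const_mul,
        inv_mul_cancel_left₀ (ofReal_ne_zero.2 (hcoef m)), integral_complex_ofReal, ofReal_re]
    -- The lower bound for the moments is independent of `α`, and the moments tend to `0` as `α →
    -- β`.
    rw [← sub_nonpos]
    refine ge_of_tendsto hlim ?_
    filter_upwards [Ioo_mem_nhdsLT hβ] with α hα
    have hαβ : |((α : ℂ) * I).im| < β := by simpa [abs_of_pos hα.1] using hα.2
    have hint := h.integrable_momentKernel (2 * m) hαβ
    rw [hker] at hint
    have hint2 := (hint.const_mul (a : ℂ)⁻¹).re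
    refine moment_lower_bound hpcont hT hpos (by have := Real.pi_pos; have := hα.1; positivity)
      (by have := Real.pi_pos; have := hα.2; gcongr) m (hint2.congr (Eventually.of_forall fun x => ?_))
    simp only [a, inv_mul_cancel_left₀ (ofReal_ne_zero.2 (hcoef m))]
    simp only [RCLike.re_to_complex, ofReal_re]
  have hc : 0 < ∫ x in Icc (-(T + 2)) (-(T + 1)), p x := by
    rw [integral_Icc_eq_integral_Ioc, ← intervalIntegral.integral_of_le (by linarith)]
    refine intervalIntegral.intervalIntegral_pos_of_pos_on (hpcont.intervalIntegrable _ _)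
      (fun x hx => hpos x ?_) (by linarith)
    rw [abs_of_neg (by linarith [hx.2])]
    linarith [hx.2]
  set c := ∫ x in Icc (-(T + 2)) (-(T + 1)), p x
  set A := ∫ x in Icc (-T) T, Real.exp (2 * Real.pi * β * T) * |p x|
  -- Geometric growth of `((T+1)/T)^(2m)` contradicts `hbound` for large `m`.
  obtain ⟨m, hm⟩ := pow_unbounded_of_one_lt (A / c)
    (show 1 < (T + 1) / T by rw [one_lt_div hT]; linarith)
  have h1 : ((T + 1) / T) ^ m ≤ ((T + 1) / T) ^ (2 * m) :=
    pow_le_pow_right₀ (by rw [one_le_div hT]; linarith) (by omega)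
  have h2 := hm.trans_le h1
  rw [div_pow, div_lt_div_iff₀ hc (by positivity)] at h2
  have := hbound m
  linarith

/-! ### Riemann's kernel and the Laplace representation of `ξ` -/

lemma re_exp_two_mul (w : ℂ) : (cexp (2 * w)).re = Real.exp (2 * w.re) * Real.cos (2 * w.im) := by
  rw [exp_re]; simp

lemma cos_two_mul_pos {y : ℝ} (hy : |y| < Real.pi / 4) : 0 < Real.cos (2 * y) :=
  Real.cos_pos_of_mem_Ioo ⟨by linarith [(abs_lt.1 hy).1], by linarith [(abs_lt.1 hy).2]⟩

lemma re_exp_two_mul_pos {w : ℂ} (hw : |w.im| < Real.pi / 4) : 0 < (cexp (2 * w)).re := by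
  rw [re_exp_two_mul]
  exact mul_pos (Real.exp_pos _) (cos_two_mul_pos hw)

lemma thetaSeries_zero_eq {z : ℂ} (hz : 0 < z.re) :
    thetaSeries 0 z = (jacobiTheta (I * z) - 1) / 2 := by
  rw [← (hasSum_nat_jacobiTheta (τ := I * z) (by simpa using hz)).tsum_eq, thetaSeries]
  refine tsum_congr fun n => ?_
  rw [pow_zero, one_mul]
  congr 1
  linear_combination (-(Real.pi * ((n : ℂ) + 1) ^ 2 * z)) * I_sq

/-- `e^(w/2) ψ(e^(2w))`. -/
noncomputable def psiExp (w : ℂ) : ℂ := cexp (w / 2) * thetaSeries 0 (cexp (2 * w))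

/-- The derivative of `psiExp`. -/
noncomputable def psiExpDeriv (w : ℂ) : ℂ :=
  cexp (w / 2) * (thetaSeries 0 (cexp (2 * w)) / 2 +
    2 * cexp (2 * w) * thetaSeries 1 (cexp (2 * w)))

/-- Riemann's kernel, whose two-sided Laplace transform is `ξ(1/2 + a)`. -/
noncomputable def xiKernel (w : ℂ) : ℂ :=
  cexp (w / 2) * (6 * cexp (2 * w) * thetaSeries 1 (cexp (2 * w)) +
    4 * cexp (2 * w) ^ 2 * thetaSeries 2 (cexp (2 * w)))

/-- `e^(w/2) θ(e^(2w))`, an even function of `w`. -/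
noncomputable def thetaExp (w : ℂ) : ℂ := cexp (w / 2) * jacobiTheta (I * cexp (2 * w))

lemma hasDerivAt_cexp_const_mul (c w : ℂ) : HasDerivAt (fun z => cexp (c * z)) (c * cexp (c * w)) w := by
  simpa [mul_comm] using ((hasDerivAt_id w).const_mul c).cexp

lemma hasDerivAt_cexp_half (w : ℂ) : HasDerivAt (fun z => cexp (z / 2)) (cexp (w / 2) / 2) w := by
  simpa [div_eq_mul_inv] using ((hasDerivAt_id w).div_const 2).cexp

lemma hasDerivAt_thetaSeries_exp (k : ℕ) {w : ℂ} (hw : |w.im| < Real.pi / 4) :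
    HasDerivAt (fun z => thetaSeries k (cexp (2 * z)))
      (thetaSeries (k + 1) (cexp (2 * w)) * (2 * cexp (2 * w))) w :=
  HasDerivAt.comp (h₂ := thetaSeries k) (h := fun z => cexp (2 * z)) w
    (hasDerivAt_thetaSeries k (re_exp_two_mul_pos hw)) (hasDerivAt_cexp_const_mul 2 w)

lemma hasDerivAt_psiExp {w : ℂ} (hw : |w.im| < Real.pi / 4) :
    HasDerivAt psiExp (psiExpDeriv w) w := by
  refine ((hasDerivAt_cexp_half w).mul (hasDerivAt_thetaSeries_exp 0 hw)).congr_deriv ?_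
  rw [psiExpDeriv]; ring

/-- The kernel is the image of `psiExp` under `d²/dw² - 1/4`, an operator that annihilates
`e^(±w/2)`. This is what the integration by parts and the evenness of the kernel use. -/
lemma hasDerivAt_psiExpDeriv {w : ℂ} (hw : |w.im| < Real.pi / 4) :
    HasDerivAt psiExpDeriv (xiKernel w + psiExp w / 4) w := by
  refine ((hasDerivAt_cexp_half w).mul (((hasDerivAt_thetaSeries_exp 0 hw).div_const 2).add
    (((hasDerivAt_cexp_const_mul 2 w).const_mul 2).mul
      (hasDerivAt_thetaSeries_exp 1 hw)))).congr_deriv ?_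
  simp only [psiExp, xiKernel, Pi.add_apply, Pi.mul_apply]; ring

lemma thetaExp_eq {w : ℂ} (hw : |w.im| < Real.pi / 4) :
    thetaExp w = cexp (w / 2) + 2 * psiExp w := by
  rw [thetaExp, psiExp, thetaSeries_zero_eq (re_exp_two_mul_pos hw)]; ring

lemma eventuallyEq_of_strip {β : ℝ} {f g : ℂ → ℂ} (h : ∀ w : ℂ, |w.im| < β → f w = g w) {w : ℂ}
    (hw : |w.im| < β) : f =ᶠ[𝓝 w] g := by
  filter_upwards [(IsStripDecaying.isOpen_strip β).mem_nhds hw] with z hz using h z hz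

lemma hasDerivAt_thetaExp {w : ℂ} (hw : |w.im| < Real.pi / 4) :
    HasDerivAt thetaExp (cexp (w / 2) / 2 + 2 * psiExpDeriv w) w :=
  ((hasDerivAt_cexp_half w).add ((hasDerivAt_psiExp hw).const_mul 2)).congr_of_eventuallyEq
    (eventuallyEq_of_strip (fun _ h => thetaExp_eq h) hw)

/-- Jacobi's inversion at `τ = i e^(2w)`; since `|im 2w| < π/2`, the principal square root of `-iτ =
e^(2w)` is `e^w`. -/
lemma thetaExp_neg {w : ℂ} (hw : |w.im| < Real.pi / 4) : thetaExp (-w) = thetaExp w := by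
  have hτ : 0 < (I * cexp (2 * w)).im := by simpa using re_exp_two_mul_pos hw
  have h := jacobiTheta_S_smul ⟨I * cexp (2 * w), hτ⟩
  rw [UpperHalfPlane.modular_S_smul] at h
  simp only at h
  have h1 : (-(I * cexp (2 * w)))⁻¹ = I * cexp (2 * -w) := by
    rw [mul_neg, Complex.exp_neg, ← neg_mul, mul_inv, inv_neg, inv_I, neg_neg]
  have h2 : (-I * (I * cexp (2 * w))) ^ (1 / 2 : ℂ) = cexp w := by
    rw [show -I * (I * cexp (2 * w)) = cexp (2 * w) by
      linear_combination (-cexp (2 * w)) * I_sq]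
    have him : (2 * w).im = 2 * w.im := by simp
    rw [cpow_def_of_ne_zero (Complex.exp_ne_zero _), log_exp (by rw [him]; linarith [(abs_lt.1 hw).1, Real.pi_pos])
      (by rw [him]; linarith [(abs_lt.1 hw).2, Real.pi_pos])]
    congr 1
    ring
  rw [h1, h2] at h
  rw [thetaExp, h, thetaExp, ← mul_assoc, ← Complex.exp_add]
  congr 2
  ring

/-- The derivative of the even function `thetaExp` is odd. At `w = 0` this yields the boundary value
`-1/4`. -/
lemma psiExpDeriv_neg {w : ℂ} (hw : |w.im| < Real.pi / 4) :
    cexp (-w / 2) / 2 + 2 * psiExpDeriv (-w) = -(cexp (w / 2) / 2 + 2 * psiExpDeriv w) := by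
  have hw' : |(-w).im| < Real.pi / 4 := by simpa using hw
  have h1 := ((hasDerivAt_thetaExp hw').scomp w (hasDerivAt_neg w)).congr_of_eventuallyEq
    (eventuallyEq_of_strip (f := thetaExp) (fun _ h => (thetaExp_neg h).symm) hw)
  have := h1.unique (hasDerivAt_thetaExp hw)
  rw [← this]
  simp

lemma psiExpDeriv_zero : psiExpDeriv 0 = -(1 / 4) := by
  have := psiExpDeriv_neg (w := 0) (by simpa using Real.pi_pos)
  simp only [neg_zero, zero_div, Complex.exp_zero] at this
  linear_combination this / 4

/-- Twice the kernel is `Θ'' - Θ/4` with `Θ` = `thetaExp` even, and second derivatives of even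
functions are even. -/
lemma xiKernel_neg {w : ℂ} (hw : |w.im| < Real.pi / 4) : xiKernel (-w) = xiKernel w := by
  have hw' : |(-w).im| < Real.pi / 4 := by simpa using hw
  have hd : ∀ {w : ℂ}, |w.im| < Real.pi / 4 → HasDerivAt
      (fun w => cexp (w / 2) / 2 + 2 * psiExpDeriv w)
      (thetaExp w / 4 + 2 * xiKernel w) w := by
    intro w hw
    refine (((hasDerivAt_cexp_half w).div_const 2).add
      ((hasDerivAt_psiExpDeriv hw).const_mul 2)).congr_deriv ?_
    rw [thetaExp_eq hw]; ring
  have h1 := (((hd hw').scomp w (hasDerivAt_neg w)).neg).congr_of_eventuallyEq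
    (f₁ := fun w => cexp (w / 2) / 2 + 2 * psiExpDeriv w)
    (eventuallyEq_of_strip (fun z h => by
      have := psiExpDeriv_neg h
      simp only [Pi.neg_apply, Function.comp_apply, this, neg_neg]) hw)
  have := h1.unique (hd hw)
  rw [thetaExp_neg hw] at this
  simp only [neg_smul, one_smul, neg_neg] at this
  linear_combination this / 2

/-- On the right half of a closed substrip, `thetaSeries k (e^(2w))` decays faster than any
exponential. -/
lemma norm_thetaSeries_exp_le (k : ℕ) {α : ℝ} (hα : α < Real.pi / 4) (N : ℝ) :
    ∃ C : ℝ, 0 ≤ C ∧ ∀ w : ℂ, |w.im| ≤ α → 0 ≤ w.re →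
      ‖thetaSeries k (cexp (2 * w))‖ ≤ C * Real.exp (-N * w.re) := by
  rcases lt_or_ge α 0 with h0 | h0
  · exact ⟨0, le_rfl, fun w hw _ => absurd ((abs_nonneg _).trans hw) (not_le.2 h0)⟩
  set c := Real.cos (2 * α) with hc
  have hcpos : 0 < c := cos_two_mul_pos (by rwa [abs_of_nonneg h0])
  obtain ⟨C, hC0, hC⟩ := norm_thetaSeries_le k hcpos
  refine ⟨C * Real.exp (N ^ 2 / (8 * c)), by positivity, fun w hw hre => ?_⟩
  have hcos : c ≤ Real.cos (2 * w.im) := by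
    rw [hc, ← Real.cos_abs (2 * w.im), abs_mul, abs_two]
    exact Real.cos_le_cos_of_nonneg_of_le_pi (by positivity) (by linarith [Real.pi_pos])
      (by linarith)
  have hsq : 2 * w.re ^ 2 ≤ Real.exp (2 * w.re) := by
    have := Real.pow_div_factorial_le_exp (2 * w.re) (by linarith) 2
    norm_num at this
    linarith
  have hx : c * Real.exp (2 * w.re) ≤ (cexp (2 * w)).re := by
    rw [re_exp_two_mul, mul_comm]
    gcongr
  have h1 : 1 ≤ Real.exp (2 * w.re) := Real.one_le_exp (by linarith)
  refine (hC _ ((le_mul_of_one_le_right hcpos.le h1).trans hx)).trans ?_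
  rw [mul_assoc, ← Real.exp_add]
  gcongr
  have h2 : c * (2 * w.re ^ 2) ≤ (cexp (2 * w)).re := (by gcongr : _ ≤ _).trans hx
  -- Completing the square: a quadratic exponent beats any linear one, at the cost of the constant
  -- `N²/(8c)`.
  have h3 : N * w.re - N ^ 2 / (8 * c) ≤ c * (2 * w.re ^ 2) := by
    rw [sub_le_iff_le_add, ← sub_nonneg]
    have : c * (2 * w.re ^ 2) + N ^ 2 / (8 * c) - N * w.re = (4 * c * w.re - N) ^ 2 / (8 * c) := by
      field_simp; ring
    rw [this]; positivity
  linarith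

lemma norm_cexp_two_mul (w : ℂ) : ‖cexp (2 * w)‖ = Real.exp (2 * w.re) := by
  rw [norm_exp]; simp

lemma norm_cexp_half (w : ℂ) : ‖cexp (w / 2)‖ = Real.exp (w.re / 2) := by
  rw [norm_exp]; simp

lemma norm_xiKernel_le {α : ℝ} (hα : α < Real.pi / 4) (N : ℝ) :
    ∃ C : ℝ, 0 ≤ C ∧ ∀ w : ℂ, |w.im| ≤ α → ‖xiKernel w‖ ≤ C * Real.exp (-N * |w.re|) := by
  -- The prefactors are at most `e^u · e^(4u)` with `u = re w ≥ 0`, so the theta factors must decay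
  -- with rate `N + 5`.
  obtain ⟨C1, h10, h1⟩ := norm_thetaSeries_exp_le 1 hα (N + 5)
  obtain ⟨C2, h20, h2⟩ := norm_thetaSeries_exp_le 2 hα (N + 5)
  have key : ∀ w : ℂ, |w.im| ≤ α → 0 ≤ w.re →
      ‖xiKernel w‖ ≤ (6 * C1 + 4 * C2) * Real.exp (-N * w.re) := by
    intro w hw hre
    have ha : ‖6 * cexp (2 * w) * thetaSeries 1 (cexp (2 * w))‖ ≤
        6 * C1 * Real.exp (4 * w.re) * Real.exp (-(N + 5) * w.re) := by
      rw [norm_mul, norm_mul, norm_cexp_two_mul, Complex.norm_ofNat]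
      have : Real.exp (2 * w.re) ≤ Real.exp (4 * w.re) := Real.exp_le_exp.2 (by linarith)
      calc _ ≤ 6 * Real.exp (4 * w.re) * (C1 * Real.exp (-(N + 5) * w.re)) := by
            gcongr; exact h1 w hw hre
        _ = _ := by ring
    have hb : ‖4 * cexp (2 * w) ^ 2 * thetaSeries 2 (cexp (2 * w))‖ ≤
        4 * C2 * Real.exp (4 * w.re) * Real.exp (-(N + 5) * w.re) := by
      rw [norm_mul, norm_mul, norm_pow, norm_cexp_two_mul, Complex.norm_ofNat, ← Real.exp_nat_mul]
      calc _ ≤ 4 * Real.exp ((2 : ℕ) * (2 * w.re)) * (C2 * Real.exp (-(N + 5) * w.re)) := by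
            gcongr; exact h2 w hw hre
        _ = _ := by push_cast; ring_nf
    rw [xiKernel, norm_mul, norm_cexp_half]
    have hh : Real.exp (w.re / 2) ≤ Real.exp w.re := Real.exp_le_exp.2 (by linarith)
    calc _ ≤ Real.exp w.re * (6 * C1 * Real.exp (4 * w.re) * Real.exp (-(N + 5) * w.re) +
          4 * C2 * Real.exp (4 * w.re) * Real.exp (-(N + 5) * w.re)) := by
          gcongr
          exact (norm_add_le _ _).trans (add_le_add ha hb)
      _ = (6 * C1 + 4 * C2) * (Real.exp w.re * Real.exp (4 * w.re) *
          Real.exp (-(N + 5) * w.re)) := by ring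
      _ = _ := by rw [← Real.exp_add, ← Real.exp_add]; ring_nf
  refine ⟨6 * C1 + 4 * C2, by positivity, fun w hw => ?_⟩
  rcases le_total 0 w.re with h | h
  · rw [abs_of_nonneg h]; exact key w hw h
  · rw [abs_of_nonpos h, ← xiKernel_neg (hw.trans_lt hα)]
    simpa using key (-w) (by simpa using hw) (by simpa using h)

lemma norm_psiExp_le (N : ℝ) : ∃ C : ℝ, 0 ≤ C ∧ ∀ u : ℝ, 0 ≤ u →
    ‖psiExp u‖ ≤ C * Real.exp (-N * u) ∧ ‖psiExpDeriv u‖ ≤ C * Real.exp (-N * u) := by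
  have hp : (0 : ℝ) < Real.pi / 4 := by positivity
  obtain ⟨C0, h00, h0⟩ := norm_thetaSeries_exp_le 0 hp (N + 3)
  obtain ⟨C1, h10, h1⟩ := norm_thetaSeries_exp_le 1 hp (N + 3)
  refine ⟨C0 + 2 * C1, by positivity, fun u hu => ?_⟩
  have h0' := h0 u (by simp) (by simpa using hu)
  have h1' := h1 u (by simp) (by simpa using hu)
  rw [ofReal_re] at h0' h1'
  have hh : Real.exp (u / 2) ≤ Real.exp u := Real.exp_le_exp.2 (by linarith)
  have h2 : (1 : ℝ) ≤ Real.exp (2 * u) := Real.one_le_exp (by linarith)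
  have hfin : Real.exp u * (Real.exp (2 * u) * Real.exp (-(N + 3) * u)) = Real.exp (-N * u) := by
    rw [← Real.exp_add, ← Real.exp_add]; ring_nf
  constructor
  · rw [psiExp, norm_mul, norm_cexp_half, ofReal_re, ← hfin]
    calc _ ≤ Real.exp u * (C0 * Real.exp (-(N + 3) * u)) := by gcongr
      _ ≤ Real.exp u * ((C0 + 2 * C1) * (Real.exp (2 * u) * Real.exp (-(N + 3) * u))) := by
        gcongr
        · linarith
        · exact le_mul_of_one_le_left (Real.exp_pos _).le h2
      _ = _ := by ring
  · rw [psiExpDeriv, norm_mul, norm_cexp_half, ofReal_re, ← hfin]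
    have ha : ‖thetaSeries 0 (cexp (2 * u)) / 2‖ ≤ C0 * (Real.exp (2 * u) * Real.exp (-(N + 3) * u)) := by
      rw [norm_div, Complex.norm_ofNat]
      calc _ ≤ C0 * Real.exp (-(N + 3) * u) / 2 := by gcongr
        _ ≤ C0 * Real.exp (-(N + 3) * u) := half_le_self (by positivity)
        _ ≤ _ := by gcongr; exact le_mul_of_one_le_left (Real.exp_pos _).le h2
    have hb : ‖2 * cexp (2 * u) * thetaSeries 1 (cexp (2 * u))‖ ≤
        2 * C1 * (Real.exp (2 * u) * Real.exp (-(N + 3) * u)) := by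
      rw [norm_mul, norm_mul, norm_cexp_two_mul, Complex.norm_ofNat, ofReal_re]
      calc _ ≤ 2 * Real.exp (2 * u) * (C1 * Real.exp (-(N + 3) * u)) := by gcongr
        _ = _ := by ring
    calc _ ≤ Real.exp u * (C0 * (Real.exp (2 * u) * Real.exp (-(N + 3) * u)) +
          2 * C1 * (Real.exp (2 * u) * Real.exp (-(N + 3) * u))) := by
          gcongr
          exact (norm_add_le _ _).trans (add_le_add ha hb)
      _ = _ := by ring

lemma differentiableOn_xiKernel : DifferentiableOn ℂ xiKernel {w | |w.im| < Real.pi / 4} := by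
  intro w hw
  refine DifferentiableAt.differentiableWithinAt ?_
  have h1 := (hasDerivAt_thetaSeries_exp 1 hw).differentiableAt
  have h2 := (hasDerivAt_thetaSeries_exp 2 hw).differentiableAt
  unfold xiKernel
  fun_prop

lemma xiKernel_ofReal (u : ℝ) : xiKernel u = ((4 * Real.exp (3 * u / 2) * thetaKernel (Real.exp (2 * u)) : ℝ) : ℂ) := by
  rw [thetaKernel_eq (Real.exp_pos _), xiKernel, ← Real.exp_mul, ← Real.exp_mul]
  have : cexp (2 * u) = ((Real.exp (2 * u) : ℝ) : ℂ) := by push_cast; rfl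
  rw [this, ← ofReal_thetaSeriesReal, ← ofReal_thetaSeriesReal]
  have h1 : Real.exp (3 * u / 2) * Real.exp (2 * u * (1 / 2)) = Real.exp (u / 2) * Real.exp (2 * u) := by
    rw [← Real.exp_add, ← Real.exp_add]; ring_nf
  have h2 : Real.exp (3 * u / 2) * Real.exp (2 * u * (3 / 2)) = Real.exp (u / 2) * Real.exp (2 * u) ^ 2 := by
    rw [← Real.exp_nat_mul, ← Real.exp_add, ← Real.exp_add]; push_cast; ring_nf
  rw [show 4 * Real.exp (3 * u / 2) * (3 / 2 * Real.exp (2 * u * (1 / 2)) * thetaSeriesReal 1 (Real.exp (2 * u)) +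
      Real.exp (2 * u * (3 / 2)) * thetaSeriesReal 2 (Real.exp (2 * u))) =
      Real.exp (u / 2) * (6 * Real.exp (2 * u) * thetaSeriesReal 1 (Real.exp (2 * u)) +
      4 * Real.exp (2 * u) ^ 2 * thetaSeriesReal 2 (Real.exp (2 * u))) by
    linear_combination 6 * thetaSeriesReal 1 (Real.exp (2 * u)) * h1 +
      4 * thetaSeriesReal 2 (Real.exp (2 * u)) * h2]
  push_cast
  rfl

lemma integral_eq_integral_Ioi_add_neg {f : ℝ → ℂ} (hf : Integrable f) :
    ∫ u, f u = ∫ u in Ioi (0 : ℝ), (f u + f (-u)) := by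
  rw [integral_add hf.integrableOn hf.comp_neg.integrableOn, integral_comp_neg_Ioi, neg_zero, add_comm]
  exact (intervalIntegral.integral_Iic_add_Ioi hf.integrableOn hf.integrableOn).symm

lemma norm_cexp_mul_ofReal_le (a : ℂ) (u : ℝ) : ‖cexp (a * u)‖ ≤ Real.exp (|a.re| * |u|) := by
  rw [norm_exp, re_mul_ofReal, ← abs_mul]
  exact Real.exp_le_exp.2 (le_abs_self _)

lemma continuous_xiKernel_ofReal : Continuous fun u : ℝ => xiKernel u :=
  differentiableOn_xiKernel.continuousOn.comp_continuous continuous_ofReal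
    fun u => by simpa using Real.pi_pos

lemma integrable_xiKernel_mul_exp (a : ℂ) : Integrable fun u : ℝ => xiKernel u * cexp (a * u) := by
  obtain ⟨C, hC0, hC⟩ := norm_xiKernel_le (α := 0) (by positivity) (|a.re| + 1)
  have hc := continuous_xiKernel_ofReal
  refine ((integrable_exp_neg_mul_abs one_pos).const_mul C).mono'
    (by fun_prop : Continuous _).aestronglyMeasurable (Eventually.of_forall fun u => ?_)
  rw [norm_mul]
  calc _ ≤ (C * Real.exp (-(|a.re| + 1) * |u|)) * Real.exp (|a.re| * |u|) := by
        gcongr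
        · simpa using hC u (by simp)
        · exact norm_cexp_mul_ofReal_le a u
    _ = _ := by rw [mul_assoc, ← Real.exp_add]; ring_nf

lemma continuous_psiExp_ofReal : Continuous fun u : ℝ => psiExp u :=
  continuous_iff_continuousAt.2 fun u =>
    (hasDerivAt_psiExp (w := u) (by simpa using Real.pi_pos)).continuousAt.comp (f := ofReal)
      continuous_ofReal.continuousAt

lemma integrable_psiExp_abs_mul_exp (a : ℂ) :
    Integrable fun u : ℝ => psiExp (|u| : ℝ) * cexp (a * u) := by
  obtain ⟨C, hC0, hC⟩ := norm_psiExp_le (|a.re| + 1)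
  have hc : Continuous fun u : ℝ => psiExp (|u| : ℝ) := continuous_psiExp_ofReal.comp continuous_abs
  refine ((integrable_exp_neg_mul_abs one_pos).const_mul C).mono'
    (by fun_prop : Continuous _).aestronglyMeasurable (Eventually.of_forall fun u => ?_)
  rw [norm_mul]
  calc _ ≤ (C * Real.exp (-(|a.re| + 1) * |u|)) * Real.exp (|a.re| * |u|) := by
        gcongr
        · exact (hC _ (abs_nonneg u)).1
        · exact norm_cexp_mul_ofReal_le a u
    _ = _ := by rw [mul_assoc, ← Real.exp_add]; ring_nf

lemma image_exp_two_mul_univ : (fun u : ℝ => Real.exp (2 * u)) '' univ = Ioi 0 := by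
  ext x
  simp only [image_univ, mem_range, mem_Ioi]
  refine ⟨fun ⟨u, hu⟩ => hu ▸ Real.exp_pos _, fun hx => ⟨Real.log x / 2, ?_⟩⟩
  rw [mul_div_cancel₀ _ two_ne_zero, Real.exp_log hx]

lemma hasDerivAt_exp_two_mul (u : ℝ) :
    HasDerivAt (fun u : ℝ => Real.exp (2 * u)) (2 * Real.exp (2 * u)) u := by
  simpa [mul_comm] using ((hasDerivAt_id u).const_mul 2).exp

lemma injective_exp_two_mul : Function.Injective fun u : ℝ => Real.exp (2 * u) :=
  fun x y h => by simpa using Real.exp_injective h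

lemma evenKernel_zero_exp (u : ℝ) :
    cexp (u / 2) * (HurwitzZeta.evenKernel 0 (Real.exp (2 * u)) : ℂ) = thetaExp u := by
  have := HurwitzZeta.evenKernel_def 0 (Real.exp (2 * u))
  rw [QuotientAddGroup.mk_zero] at this
  rw [this, thetaExp, jacobiTheta_eq_jacobiTheta₂]
  simp

/-- The modified function in the Mellin transform for `Λ₀` is theta minus `1` for `x > 1` and minus
`x^(-1/2)` for `x < 1`. After multiplication by `e^(u/2)`, theta inversion makes both branches equal
to `2 psiExp |u|`. The point `u = 0`, where both indicators vanish, is excluded. -/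
lemma f_modif_exp (a : ℂ) {u : ℝ} (hu : u ≠ 0) :
    (HurwitzZeta.hurwitzEvenFEPair 0).f_modif (Real.exp (2 * u)) * cexp ((1 / 2 + a) * u) =
      2 * (psiExp (|u| : ℝ) * cexp (a * u)) := by
  have hs : |((u : ℝ) : ℂ).im| < Real.pi / 4 := by simpa using Real.pi_pos
  have he : cexp ((1 / 2 + a) * u) = cexp (u / 2) * cexp (a * u) := by
    rw [← Complex.exp_add]; ring_nf
  have ht := evenKernel_zero_exp u
  rw [he, ← mul_assoc, ← mul_assoc]
  congr 1
  rcases lt_or_gt_of_ne hu with h | h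
  · have h1 : Real.exp (2 * u) < 1 := by rw [Real.exp_lt_one_iff]; linarith
    have hm : Real.exp (2 * u) ∈ Ioo (0 : ℝ) 1 := ⟨Real.exp_pos _, h1⟩
    rw [WeakFEPair.f_modif, Pi.add_apply, indicator_of_notMem (notMem_Ioi.2 h1.le),
      indicator_of_mem hm, zero_add]
    simp only [HurwitzZeta.hurwitzEvenFEPair, Function.comp_apply]
    rw [abs_of_neg h, ofReal_neg]
    have h2 := thetaExp_eq (w := -(u : ℂ)) (by simpa using Real.pi_pos)
    rw [thetaExp_neg hs] at h2
    have h3 : ((Real.exp (2 * u) ^ (-(1 / 2) : ℝ) : ℝ) : ℂ) * cexp (u / 2) = cexp (-u / 2) := by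
      rw [← Real.exp_mul, ofReal_exp, ← Complex.exp_add]
      congr 1; push_cast; ring
    simp only [smul_eq_mul, mul_one, one_mul]
    linear_combination ht + h2 - h3
  · have h1 : 1 < Real.exp (2 * u) := Real.one_lt_exp_iff.2 (by linarith)
    rw [WeakFEPair.f_modif, Pi.add_apply, indicator_of_mem (mem_Ioi.2 h1),
      indicator_of_notMem (fun hh => by linarith [hh.2]), add_zero]
    simp only [HurwitzZeta.hurwitzEvenFEPair, Function.comp_apply, if_true]
    rw [abs_of_pos h]
    linear_combination ht + thetaExp_eq hs

lemma completedRiemannZeta₀_eq_integral (a : ℂ) :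
    completedRiemannZeta₀ (1 / 2 + a) = 2 * ∫ u : ℝ, psiExp (|u| : ℝ) * cexp (a * u) := by
  rw [completedRiemannZeta₀, HurwitzZeta.completedHurwitzZetaEven₀, WeakFEPair.Λ₀, mellin,
    ← image_exp_two_mul_univ, integral_image_eq_integral_abs_deriv_smul MeasurableSet.univ
      (fun u _ => (hasDerivAt_exp_two_mul u).hasDerivWithinAt) injective_exp_two_mul.injOn,
    setIntegral_univ, ← integral_const_mul, div_eq_mul_inv, ← integral_mul_const]
  refine integral_congr_ae ?_
  have hne : ∀ᵐ u : ℝ, u ≠ 0 := by simp [ae_iff]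
  filter_upwards [hne] with u hu
  rw [← f_modif_exp a hu, abs_of_pos (by positivity), real_smul, smul_eq_mul]
  have h1 : ((Real.exp (2 * u) : ℝ) : ℂ) ^ ((1 / 2 + a) / 2 - 1) * Real.exp (2 * u) =
      cexp ((1 / 2 + a) * u) := by
    rw [ofReal_exp, cpow_def_of_ne_zero (Complex.exp_ne_zero _), ← ofReal_exp, ← ofReal_log (Real.exp_pos _).le,
      Real.log_exp, ofReal_exp, ← Complex.exp_add]
    congr 1; push_cast; ring
  rw [← h1]
  push_cast
  ring

lemma tendsto_mul_cosh_zero {f : ℝ → ℂ} {a b : ℂ} {C : ℝ}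
    (hf : ∀ u : ℝ, 0 ≤ u → ‖f u‖ ≤ C * Real.exp (-(|a.re| + 1) * u)) :
    Tendsto (fun u : ℝ => f u * (cexp (a * u) + b * cexp (-a * u))) atTop (𝓝 0) := by
  have hz : Tendsto (fun u : ℝ => C * (1 + ‖b‖) * Real.exp (-u)) atTop (𝓝 0) := by
    simpa using (Real.tendsto_exp_neg_atTop_nhds_zero).const_mul (C * (1 + ‖b‖))
  refine squeeze_zero_norm' ?_ hz
  filter_upwards [eventually_ge_atTop 0] with u hu
  have h1 := norm_cexp_mul_ofReal_le a u
  have h2 := norm_cexp_mul_ofReal_le (-a) u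
  rw [neg_re, abs_neg] at h2
  rw [abs_of_nonneg hu] at h1 h2
  rw [norm_mul]
  have h3 : ‖cexp (a * u) + b * cexp (-a * u)‖ ≤ (1 + ‖b‖) * Real.exp (|a.re| * u) := by
    calc _ ≤ Real.exp (|a.re| * u) + ‖b‖ * Real.exp (|a.re| * u) := by
          refine (norm_add_le _ _).trans (add_le_add h1 ?_)
          rw [norm_mul]; gcongr
      _ = _ := by ring
  have h4 := (norm_nonneg _).trans (hf u hu)
  calc _ ≤ (C * Real.exp (-(|a.re| + 1) * u)) * ((1 + ‖b‖) * Real.exp (|a.re| * u)) := by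
        gcongr; exact hf u hu
    _ = C * (1 + ‖b‖) * (Real.exp (-(|a.re| + 1) * u) * Real.exp (|a.re| * u)) := by ring
    _ = _ := by rw [← Real.exp_add]; ring_nf

/-- Riemann's representation of `ξ` as a two-sided Laplace transform. -/
lemma entireXi_eq_integral (a : ℂ) :
    entireXi (1 / 2 + a) = ∫ u : ℝ, xiKernel u * cexp (a * u) := by
  have hs : ∀ u : ℝ, |((u : ℝ) : ℂ).im| < Real.pi / 4 := fun u => by simpa using Real.pi_pos
  have hH := integrable_xiKernel_mul_exp a
  have hg := integrable_psiExp_abs_mul_exp a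
  have h1 : ∫ u : ℝ, xiKernel u * cexp (a * u) =
      ∫ u in Ioi (0 : ℝ), xiKernel u * (cexp (a * u) + cexp (-a * u)) := by
    rw [integral_eq_integral_Ioi_add_neg hH]
    refine setIntegral_congr_fun measurableSet_Ioi fun u _ => ?_
    simp only [ofReal_neg, xiKernel_neg (hs u)]
    ring_nf
  have h2 : ∫ u : ℝ, psiExp (|u| : ℝ) * cexp (a * u) =
      ∫ u in Ioi (0 : ℝ), psiExp u * (cexp (a * u) + cexp (-a * u)) := by
    rw [integral_eq_integral_Ioi_add_neg hg]
    refine setIntegral_congr_fun measurableSet_Ioi fun u hu => ?_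
    simp only [abs_neg, abs_of_pos (mem_Ioi.1 hu), ofReal_neg]
    ring_nf
  have hH' : IntegrableOn (fun u : ℝ => xiKernel u * (cexp (a * u) + cexp (-a * u))) (Ioi 0) := by
    have := (hH.add (integrable_xiKernel_mul_exp (-a))).integrableOn (s := Ioi 0)
    refine this.congr_fun (fun u _ => ?_) measurableSet_Ioi
    simp only [Pi.add_apply]; ring
  have hg' : IntegrableOn (fun u : ℝ => psiExp u * (cexp (a * u) + cexp (-a * u))) (Ioi 0) := by
    have := (hg.add (integrable_psiExp_abs_mul_exp (-a))).integrableOn (s := Ioi 0)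
    refine this.congr_fun (fun u hu => ?_) measurableSet_Ioi
    simp only [Pi.add_apply, abs_of_pos (mem_Ioi.1 hu)]; ring
  have hE : ∀ c : ℂ, ∀ u : ℝ, HasDerivAt (fun u : ℝ => cexp (c * u)) (c * cexp (c * u)) u := fun c u =>
    (hasDerivAt_cexp_const_mul c u).comp_ofReal
  -- Two integrations by parts packed into one antiderivative, `P' · 2cosh(au) - a P · 2sinh(au)`
  -- with `P` = `psiExp`. Its value at `0` is `2P'(0) = -1/2`, which accounts for the `+ 1` in
  -- `entireXi`, and `s(s-1) = a² - 1/4` at `s = 1/2 + a`.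
  have hderiv : ∀ u ∈ Ici (0 : ℝ), HasDerivAt (fun u : ℝ =>
      psiExpDeriv u * (cexp (a * u) + 1 * cexp (-a * u)) -
        a * (psiExp u * (cexp (a * u) + (-1) * cexp (-a * u))))
      (xiKernel u * (cexp (a * u) + cexp (-a * u)) +
        (1 / 4 - a ^ 2) * (psiExp u * (cexp (a * u) + cexp (-a * u)))) u := by
    intro u _
    have d1 := (hasDerivAt_psiExpDeriv (hs u)).comp_ofReal
    have d2 := (hasDerivAt_psiExp (hs u)).comp_ofReal
    refine ((d1.mul ((hE a u).add ((hE (-a) u).const_mul 1))).sub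
      ((d2.mul ((hE a u).add ((hE (-a) u).const_mul (-1)))).const_mul a)).congr_deriv ?_
    simp only [Pi.add_apply]
    ring
  obtain ⟨C, hC0, hC⟩ := norm_psiExp_le (|a.re| + 1)
  have hlim : Tendsto (fun u : ℝ =>
      psiExpDeriv u * (cexp (a * u) + 1 * cexp (-a * u)) -
        a * (psiExp u * (cexp (a * u) + (-1) * cexp (-a * u)))) atTop (𝓝 0) := by
    simpa using (tendsto_mul_cosh_zero (b := 1) fun u hu => (hC u hu).2).sub
      ((tendsto_mul_cosh_zero (b := -1) fun u hu => (hC u hu).1).const_mul a)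
  have hftc := integral_Ioi_of_hasDerivAt_of_tendsto' hderiv
    (hH'.add (hg'.const_mul (1 / 4 - a ^ 2))) hlim
  rw [integral_add hH' (hg'.const_mul _), integral_const_mul] at hftc
  simp only [ofReal_zero, mul_zero, Complex.exp_zero, psiExpDeriv_zero] at hftc
  rw [entireXi, completedRiemannZeta₀_eq_integral, h1, h2]
  linear_combination -hftc

/-! ### Exponentially bounded weights and their Fourier–Laplace transforms -/

/-- A continuous weight on the line with exponential decay of rate `b`. -/
structure IsExpBounded (p : ℝ → ℂ) (b : ℝ) : Prop where
  continuous : Continuous p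
  bound : ∃ C : ℝ, 0 ≤ C ∧ ∀ t : ℝ, ‖p t‖ ≤ C * Real.exp (-b * |t|)

/-- The Fourier–Laplace transform `∫ p(t) e^(itw) dt`. -/
noncomputable def charTransform (p : ℝ → ℂ) (w : ℂ) : ℂ := ∫ t : ℝ, p t * cexp (I * t * w)

lemma norm_cexp_I_mul_le (t : ℝ) (w : ℂ) : ‖cexp (I * t * w)‖ ≤ Real.exp (|w.im| * |t|) := by
  rw [norm_exp]
  refine Real.exp_le_exp.2 ?_
  have : (I * t * w).re = -(t * w.im) := by simp [mul_assoc]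
  rw [this, mul_comm |w.im|, ← abs_mul]
  exact neg_le_abs _

namespace IsExpBounded

variable {p : ℝ → ℂ} {b : ℝ}

lemma norm_mul_cexp_le (h : IsExpBounded p b) {α : ℝ} :
    ∃ C : ℝ, 0 ≤ C ∧ ∀ w : ℂ, |w.im| ≤ α → ∀ t : ℝ,
      ‖p t * cexp (I * t * w)‖ ≤ C * Real.exp (-(b - α) * |t|) := by
  obtain ⟨C, hC0, hC⟩ := h.bound
  refine ⟨C, hC0, fun w hw t => ?_⟩
  rw [norm_mul]
  calc _ ≤ (C * Real.exp (-b * |t|)) * Real.exp (|w.im| * |t|) := by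
        gcongr
        · exact hC t
        · exact norm_cexp_I_mul_le t w
    _ ≤ (C * Real.exp (-b * |t|)) * Real.exp (α * |t|) := by gcongr
    _ = _ := by rw [mul_assoc, ← Real.exp_add]; ring_nf

lemma integrable_mul_cexp (h : IsExpBounded p b) {w : ℂ} (hw : |w.im| < b) :
    Integrable fun t : ℝ => p t * cexp (I * t * w) := by
  obtain ⟨C, -, hC⟩ := h.norm_mul_cexp_le (α := |w.im|)
  have := h.continuous
  exact ((integrable_exp_neg_mul_abs (sub_pos.2 hw)).const_mul C).mono'
    (by fun_prop : Continuous _).aestronglyMeasurable (Eventually.of_forall (hC w le_rfl))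

lemma integrable (h : IsExpBounded p b) (hb : 0 < b) : Integrable p := by
  simpa using h.integrable_mul_cexp (w := 0) (by simpa)

lemma norm_charTransform_le (h : IsExpBounded p b) {α : ℝ} (hα : α < b) :
    ∃ C : ℝ, 0 ≤ C ∧ ∀ w : ℂ, |w.im| ≤ α → ‖charTransform p w‖ ≤ C := by
  obtain ⟨C, hC0, hC⟩ := h.norm_mul_cexp_le (α := α)
  refine ⟨∫ t : ℝ, C * Real.exp (-(b - α) * |t|), integral_nonneg fun t => by positivity,
    fun w hw => norm_integral_le_of_norm_le
      ((integrable_exp_neg_mul_abs (sub_pos.2 hα)).const_mul C) (Eventually.of_forall (hC w hw))⟩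

/-- A factor `t` costs an arbitrarily small part of the decay rate. -/
lemma mul_self (h : IsExpBounded p b) {b' : ℝ} (hb : b' < b) :
    IsExpBounded (fun t => I * t * p t) b' := by
  obtain ⟨C, hC0, hC⟩ := h.bound
  have hd := sub_pos.2 hb
  have hc := h.continuous
  refine ⟨by fun_prop, (b - b')⁻¹ * C, by positivity, fun t => ?_⟩
  have h1 : |t| ≤ (b - b')⁻¹ * Real.exp ((b - b') * |t|) := by
    rw [inv_mul_eq_div, le_div_iff₀ hd]
    linarith [Real.add_one_le_exp ((b - b') * |t|)]
  rw [norm_mul, norm_mul, norm_I, one_mul, norm_real, Real.norm_eq_abs]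
  calc _ ≤ ((b - b')⁻¹ * Real.exp ((b - b') * |t|)) * (C * Real.exp (-b * |t|)) := by
        gcongr; exact hC t
    _ = (b - b')⁻¹ * C * (Real.exp ((b - b') * |t|) * Real.exp (-b * |t|)) := by ring
    _ = _ := by rw [← Real.exp_add]; ring_nf

lemma hasDerivAt_charTransform (h : IsExpBounded p b) {w : ℂ} (hw : |w.im| < b) :
    HasDerivAt (charTransform p) (charTransform (fun t => I * t * p t) w) w := by
  obtain ⟨α, hα, hαb⟩ := exists_between hw
  obtain ⟨b', hb', hb'b⟩ := exists_between hαb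
  have h' := h.mul_self hb'b
  obtain ⟨C, hC0, hC⟩ := h'.norm_mul_cexp_le (α := α)
  have hc := h.continuous
  refine (hasDerivAt_integral_of_dominated_loc_of_deriv_le
    ((IsStripDecaying.isOpen_strip α).mem_nhds hα) (Eventually.of_forall fun z =>
      (by fun_prop : Continuous fun t : ℝ => p t * cexp (I * t * z)).aestronglyMeasurable)
    (h.integrable_mul_cexp hw)
    (by fun_prop : Continuous fun t : ℝ => I * t * p t * cexp (I * t * w)).aestronglyMeasurable
    (Eventually.of_forall fun t z hz => hC z (le_of_lt hz) t)
    ((integrable_exp_neg_mul_abs (sub_pos.2 hb')).const_mul C)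
    (Eventually.of_forall fun t z _ => ?_)).2
  refine ((hasDerivAt_cexp_const_mul (I * t) z).const_mul (p t)).congr_deriv ?_
  ring

end IsExpBounded

/-! ### The Bernoulli weights and their transforms by the beta integral -/

lemma half_exp_abs_le_cosh (t : ℝ) : Real.exp |t| / 2 ≤ Real.cosh t := by
  rw [← Real.cosh_abs, Real.cosh_eq]
  have := Real.exp_pos (-|t|)
  linarith

lemma continuous_bernoulliDensity : Continuous bernoulliDensity := by
  unfold bernoulliDensity
  refine Continuous.div continuous_const (by fun_prop) fun t => ?_
  have := Real.cosh_pos (Real.pi * t)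
  positivity

lemma bernoulliDensity_mul_cosh (t : ℝ) :
    bernoulliDensity t * Real.cosh (Real.pi * t) = Real.pi / 2 / Real.cosh (Real.pi * t) := by
  have := (Real.cosh_pos (Real.pi * t)).ne'
  rw [bernoulliDensity]
  field_simp

lemma bernoulliDensity_nonneg (t : ℝ) : 0 ≤ bernoulliDensity t := by
  unfold bernoulliDensity
  positivity

lemma isExpBounded_cosh_weight :
    IsExpBounded (fun t => (bernoulliDensity t : ℂ) * Real.cosh (Real.pi * t)) Real.pi := by
  have := continuous_bernoulliDensity
  refine ⟨by fun_prop, Real.pi, Real.pi_pos.le, fun t => ?_⟩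
  rw [← ofReal_mul, norm_real, bernoulliDensity_mul_cosh, Real.norm_of_nonneg (by
    have := Real.cosh_pos (Real.pi * t); positivity)]
  have h1 := half_exp_abs_le_cosh (Real.pi * t)
  rw [abs_mul, abs_of_pos Real.pi_pos] at h1
  rw [neg_mul, Real.exp_neg, ← div_eq_mul_inv, div_div]
  rw [div_le_div_iff₀ (by have := Real.cosh_pos (Real.pi * t); positivity) (Real.exp_pos _)]
  nlinarith [Real.pi_pos]

lemma isExpBounded_bernoulliDensity :
    IsExpBounded (fun t => (bernoulliDensity t : ℂ)) (2 * Real.pi) := by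
  have := continuous_bernoulliDensity
  refine ⟨by fun_prop, 2 * Real.pi, by positivity, fun t => ?_⟩
  rw [norm_real, Real.norm_of_nonneg (bernoulliDensity_nonneg t), bernoulliDensity]
  have h1 := half_exp_abs_le_cosh (Real.pi * t)
  rw [abs_mul, abs_of_pos Real.pi_pos] at h1
  have h2 : Real.exp (2 * Real.pi * |t|) / 4 ≤ Real.cosh (Real.pi * t) ^ 2 := by
    calc _ = (Real.exp (Real.pi * |t|) / 2) ^ 2 := by
          rw [div_pow, ← Real.exp_nat_mul]; push_cast; ring_nf
      _ ≤ _ := by gcongr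
  rw [neg_mul, Real.exp_neg, ← div_eq_mul_inv, div_div]
  rw [div_le_div_iff₀ (by have := Real.cosh_pos (Real.pi * t); positivity) (Real.exp_pos _)]
  nlinarith [Real.pi_pos]

/-- The logistic function `1 / (1 + e^(-2πt))`. -/
noncomputable def logisticPi (t : ℝ) : ℝ := (1 + Real.exp (-(2 * Real.pi) * t))⁻¹

lemma one_sub_logisticPi (t : ℝ) :
    1 - logisticPi t = Real.exp (-(2 * Real.pi) * t) * logisticPi t := by
  have : (0 : ℝ) < 1 + Real.exp (-(2 * Real.pi) * t) := by positivity
  rw [logisticPi]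
  field_simp
  ring

lemma logisticPi_pos (t : ℝ) : 0 < logisticPi t := by unfold logisticPi; positivity

lemma one_sub_logisticPi_pos (t : ℝ) : 0 < 1 - logisticPi t := by
  rw [one_sub_logisticPi]
  have := logisticPi_pos t
  positivity

lemma hasDerivAt_logisticPi (t : ℝ) :
    HasDerivAt logisticPi (2 * Real.pi * (logisticPi t * (1 - logisticPi t))) t := by
  have h0 : (1 + Real.exp (-(2 * Real.pi) * t)) ≠ 0 := by positivity
  have h1 : HasDerivAt (fun t : ℝ => 1 + Real.exp (-(2 * Real.pi) * t))
      (-(2 * Real.pi) * Real.exp (-(2 * Real.pi) * t)) t := by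
    simpa [mul_comm] using (((hasDerivAt_id t).const_mul (-(2 * Real.pi))).exp).const_add 1
  refine (h1.inv h0).congr_deriv ?_
  rw [one_sub_logisticPi, logisticPi]
  field_simp

lemma image_logisticPi : logisticPi '' univ = Ioo 0 1 := by
  ext x
  simp only [image_univ, mem_range, mem_Ioo]
  refine ⟨fun ⟨t, ht⟩ => ht ▸ ⟨logisticPi_pos t, sub_pos.1 (one_sub_logisticPi_pos t)⟩, fun ⟨h0, h1⟩ =>
    ⟨-Real.log (x⁻¹ - 1) / (2 * Real.pi), ?_⟩⟩
  have hx : 0 < x⁻¹ - 1 := sub_pos.2 ((one_lt_inv₀ h0).2 h1)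
  have hp := Real.pi_pos
  rw [logisticPi, show -(2 * Real.pi) * (-Real.log (x⁻¹ - 1) / (2 * Real.pi)) = Real.log (x⁻¹ - 1) by
    field_simp, Real.exp_log hx]
  simp

lemma injective_logisticPi : Function.Injective logisticPi := by
  intro s t h
  have h1 := inv_injective h
  have h2 := Real.exp_injective (add_left_cancel h1)
  exact mul_left_cancel₀ (by have := Real.pi_pos; simp [this.ne']) h2

lemma logisticPi_mul (t : ℝ) :
    logisticPi t * (1 - logisticPi t) = (2 * Real.cosh (Real.pi * t))⁻¹ ^ 2 := by
  have h0 : (1 + Real.exp (-(2 * Real.pi) * t)) ≠ 0 := by positivity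
  have h1 : Real.exp (-(2 * Real.pi) * t) = Real.exp (-(Real.pi * t)) ^ 2 := by
    rw [← Real.exp_nat_mul]; push_cast; ring_nf
  have h2 : Real.exp (Real.pi * t) * Real.exp (-(Real.pi * t)) = 1 := by
    rw [← Real.exp_add]; simp
  have h3 : 2 * Real.cosh (Real.pi * t) = Real.exp (Real.pi * t) + Real.exp (-(Real.pi * t)) := by
    rw [Real.cosh_eq]; ring
  have hE := Real.exp_pos (Real.pi * t)
  have hE' := Real.exp_pos (-(Real.pi * t))
  have h4 : 2 * Real.cosh (Real.pi * t) =
      Real.exp (Real.pi * t) * (1 + Real.exp (-(2 * Real.pi) * t)) := by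
    rw [h3, h1]; linear_combination (-Real.exp (-(Real.pi * t))) * h2
  rw [one_sub_logisticPi, logisticPi, h4, mul_inv, mul_pow, h1]
  have h5 : (Real.exp (Real.pi * t))⁻¹ = Real.exp (-(Real.pi * t)) := (Real.exp_neg _).symm
  rw [h5]
  ring

/-- The beta integral in logistic coordinates. -/
lemma betaIntegral_eq_integral_cosh (p : ℝ) (q : ℂ) :
    betaIntegral (p + q) (p - q) = ∫ t : ℝ, 2 * Real.pi *
      (((2 * Real.cosh (Real.pi * t))⁻¹ ^ 2) ^ p : ℝ) * cexp (2 * Real.pi * q * t) := by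
  rw [betaIntegral, intervalIntegral.integral_of_le zero_le_one, integral_Ioc_eq_integral_Ioo,
    ← image_logisticPi, integral_image_eq_integral_abs_deriv_smul MeasurableSet.univ
      (fun t _ => (hasDerivAt_logisticPi t).hasDerivWithinAt) injective_logisticPi.injOn,
    setIntegral_univ]
  refine integral_congr_ae (Eventually.of_forall fun t => ?_)
  have hL := logisticPi_pos t
  have hM := one_sub_logisticPi_pos t
  -- With `L` the logistic function, `log L - log(1-L) = 2πt`, so the asymmetry `q` of the exponents
  -- becomes `e^(2πqt)`; the derivative of `L` raises the power of `L(1-L)` from `p - 1` to `p`.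
  have hlog : Real.log (logisticPi t) - Real.log (1 - logisticPi t) = 2 * Real.pi * t := by
    rw [one_sub_logisticPi, Real.log_mul (Real.exp_ne_zero _) hL.ne', Real.log_exp]
    ring
  have hlogc : (Real.log (logisticPi t) : ℂ) - Real.log (1 - logisticPi t) = 2 * Real.pi * t := by
    exact_mod_cast congrArg (fun x : ℝ => (x : ℂ)) hlog
  dsimp only
  rw [← logisticPi_mul, abs_of_pos (by have := Real.pi_pos; positivity), real_smul,
    Real.rpow_def_of_pos (mul_pos hL hM), Real.log_mul hL.ne' hM.ne',
    ← ofReal_one, ← ofReal_sub, cpow_def_of_ne_zero (ofReal_ne_zero.2 hL.ne'),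
    cpow_def_of_ne_zero (ofReal_ne_zero.2 hM.ne'), ← ofReal_log hL.le, ← ofReal_log hM.le]
  have hLe : (logisticPi t : ℂ) = cexp (Real.log (logisticPi t)) := by
    rw [← ofReal_exp, Real.exp_log hL]
  have hMe : ((1 - logisticPi t : ℝ) : ℂ) = cexp (Real.log (1 - logisticPi t)) := by
    rw [← ofReal_exp, Real.exp_log hM]
  simp only [ofReal_mul]
  rw [hLe, hMe]
  generalize Real.log (logisticPi t) = a at *
  generalize Real.log (1 - logisticPi t) = b at *
  push_cast
  rw [mul_assoc _ (cexp _), ← Complex.exp_add, mul_assoc _ (cexp _), ← Complex.exp_add,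
    ← Complex.exp_add, ← Complex.exp_add]
  congr 2
  linear_combination q * hlogc

lemma charTransform_bernoulliDensity_eq_beta (u : ℝ) :
    charTransform (fun t => (bernoulliDensity t : ℂ)) u =
      betaIntegral (1 + u / (2 * Real.pi) * I) (1 - u / (2 * Real.pi) * I) := by
  have h := betaIntegral_eq_integral_cosh 1 (u / (2 * Real.pi) * I)
  rw [ofReal_one] at h
  rw [h, charTransform]
  have hp := ofReal_ne_zero.2 Real.pi_ne_zero
  congr 1
  ext t
  have hc : (Real.cosh (Real.pi * t) : ℂ) ≠ 0 := ofReal_ne_zero.2 (Real.cosh_pos _).ne'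
  congr 1
  · rw [Real.rpow_one, bernoulliDensity]
    push_cast at hc ⊢
    field_simp
  · congr 1
    field_simp

lemma charTransform_cosh_weight_eq_beta (u : ℝ) :
    charTransform (fun t => (bernoulliDensity t : ℂ) * Real.cosh (Real.pi * t)) u =
      betaIntegral (1 / 2 + u / (2 * Real.pi) * I) (1 / 2 - u / (2 * Real.pi) * I) / 2 := by
  have h := betaIntegral_eq_integral_cosh (1 / 2) (u / (2 * Real.pi) * I)
  rw [ofReal_div, ofReal_one, ofReal_ofNat] at h
  rw [h, charTransform, div_eq_mul_inv, ← integral_mul_const]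
  have hp := ofReal_ne_zero.2 Real.pi_ne_zero
  congr 1
  ext t
  have hpos := Real.cosh_pos (Real.pi * t)
  have hc : (Real.cosh (Real.pi * t) : ℂ) ≠ 0 := ofReal_ne_zero.2 hpos.ne'
  rw [← Real.sqrt_eq_rpow, Real.sqrt_sq (by positivity), ← ofReal_mul, bernoulliDensity_mul_cosh]
  have he : 2 * (Real.pi : ℂ) * (u / (2 * Real.pi) * I) * t = I * t * u := by field_simp
  rw [he]
  push_cast at hc ⊢
  field_simp

/-- The characteristic function of the logistic law. -/
lemma charTransform_bernoulliDensity {u : ℝ} (hu : u ≠ 0) :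
    charTransform (fun t => (bernoulliDensity t : ℂ)) u =
      ((u / 2 / Real.sinh (u / 2) : ℝ) : ℂ) := by
  have hp := ofReal_ne_zero.2 Real.pi_ne_zero
  rw [charTransform_bernoulliDensity_eq_beta]
  set q : ℂ := u / (2 * Real.pi) * I with hq
  have hqre : q.re = 0 := by
    rw [hq, show (u / (2 * Real.pi) : ℂ) = ((u / (2 * Real.pi) : ℝ) : ℂ) by push_cast; rfl]
    rw [mul_I_re, ofReal_im, neg_zero]
  have hq0 : q ≠ 0 := by
    rw [hq]
    exact mul_ne_zero (div_ne_zero (ofReal_ne_zero.2 hu) (mul_ne_zero two_ne_zero hp)) I_ne_zero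
  -- `Γ(1+q)Γ(1-q) = πq / sin(πq)` with `πq = iu/2`. At `u = 0` the quotient in the statement would
  -- be the default value `0` instead of `1`.
  have h := Gamma_mul_Gamma_eq_betaIntegral (s := 1 + q) (t := 1 - q) (by simp [hqre]) (by simp [hqre])
  have h2 : Gamma (1 + q + (1 - q)) = 1 := by
    rw [show 1 + q + (1 - q) = 1 + 1 by ring, Gamma_add_one _ one_ne_zero, Gamma_one, one_mul]
  rw [h2, one_mul, add_comm 1 q, Gamma_add_one q hq0, mul_assoc, Gamma_mul_Gamma_one_sub] at h
  rw [add_comm 1 q, ← h]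
  have h3 : Real.pi * q = (u / 2 : ℂ) * I := by rw [hq]; field_simp
  rw [h3, sin_mul_I]
  have hs : (Real.sinh (u / 2) : ℂ) ≠ 0 := by
    rw [ofReal_ne_zero, Ne, Real.sinh_eq_zero]
    simpa using hu
  push_cast at hs ⊢
  rw [hq]
  field_simp

lemma charTransform_cosh_weight (u : ℝ) :
    charTransform (fun t => (bernoulliDensity t : ℂ) * Real.cosh (Real.pi * t)) u =
      ((Real.pi / (2 * Real.cosh (u / 2)) : ℝ) : ℂ) := by
  have hp := ofReal_ne_zero.2 Real.pi_ne_zero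
  rw [charTransform_cosh_weight_eq_beta]
  set q : ℂ := u / (2 * Real.pi) * I with hq
  have hqre : q.re = 0 := by
    rw [hq, show (u / (2 * Real.pi) : ℂ) = ((u / (2 * Real.pi) : ℝ) : ℂ) by push_cast; rfl]
    rw [mul_I_re, ofReal_im, neg_zero]
  -- Reflection gives `Γ(1/2+q)Γ(1/2-q) = π / cos(πq)`, again with `πq = iu/2`.
  have h := Gamma_mul_Gamma_eq_betaIntegral (s := 1 / 2 + q) (t := 1 / 2 - q)
    (by simp [hqre]) (by simp [hqre])
  have h2 : Gamma (1 / 2 + q + (1 / 2 - q)) = 1 := by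
    rw [show 1 / 2 + q + (1 / 2 - q) = 1 by ring, Gamma_one]
  have h4 : (1 / 2 - q) = 1 - (1 / 2 + q) := by ring
  rw [h2, one_mul, h4, Gamma_mul_Gamma_one_sub] at h
  have h3 : Real.pi * (1 / 2 + q) = (u / 2 : ℂ) * I + Real.pi / 2 := by rw [hq]; field_simp; ring
  rw [h4, ← h, h3, Complex.sin_add_pi_div_two, cos_mul_I]
  have hc : (Real.cosh (u / 2) : ℂ) ≠ 0 := ofReal_ne_zero.2 (Real.cosh_pos _).ne'
  push_cast at hc ⊢
  field_simp

/-! ### Bernoulli numbers as moments, and the exponential values -/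

namespace IsExpBounded

variable {p q : ℝ → ℂ} {b : ℝ}

lemma add (hp : IsExpBounded p b) (hq : IsExpBounded q b) : IsExpBounded (fun t => p t + q t) b := by
  obtain ⟨C, hC0, hC⟩ := hp.bound
  obtain ⟨D, hD0, hD⟩ := hq.bound
  refine ⟨hp.continuous.add hq.continuous, C + D, by positivity, fun t => ?_⟩
  rw [add_mul]
  exact (norm_add_le _ _).trans (add_le_add (hC t) (hD t))

lemma const_mul (hp : IsExpBounded p b) (c : ℂ) : IsExpBounded (fun t => c * p t) b := by
  obtain ⟨C, hC0, hC⟩ := hp.bound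
  refine ⟨continuous_const.mul hp.continuous, ‖c‖ * C, by positivity, fun t => ?_⟩
  rw [norm_mul, mul_assoc]
  gcongr
  exact hC t

end IsExpBounded

lemma isExpBounded_bernoulliDensity_mul_pow (c : ℂ) (k : ℕ) :
    ∀ b < 2 * Real.pi, IsExpBounded (fun t => (bernoulliDensity t : ℂ) * (c + t * I) ^ k) b := by
  induction k with
  | zero =>
    intro b hb
    obtain ⟨hc, C, hC0, hC⟩ := isExpBounded_bernoulliDensity
    refine ⟨by simpa using hc, C, hC0, fun t => ?_⟩
    rw [pow_zero, mul_one]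
    refine (hC t).trans ?_
    gcongr
  | succ k ih =>
    intro b hb
    obtain ⟨b', h1, h2⟩ := exists_between hb
    convert! ((ih b hb).const_mul c).add ((ih b' h2).mul_self h1) using 2 with t
    ring

/-- `∫ (c + it)^k e^((c + it)z)` against the Bernoulli density. -/
noncomputable def bernoulliMoment (c : ℂ) (k : ℕ) (z : ℂ) : ℂ :=
  cexp (c * z) * charTransform (fun t => (bernoulliDensity t : ℂ) * (c + t * I) ^ k) z

lemma hasDerivAt_bernoulliMoment (c : ℂ) (k : ℕ) {z : ℂ} (hz : |z.im| < Real.pi) :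
    HasDerivAt (bernoulliMoment c k) (bernoulliMoment c (k + 1) z) z := by
  have hpi := Real.pi_pos
  -- Any rate strictly between `π` and `2π` will do: the extra factor `t` then still leaves rate
  -- `π`.
  have h1 := isExpBounded_bernoulliDensity_mul_pow c k (3 / 2 * Real.pi) (by linarith)
  have h2 := h1.mul_self (b' := Real.pi) (by linarith)
  refine ((hasDerivAt_cexp_const_mul c z).mul
    (h1.hasDerivAt_charTransform (by linarith))).congr_deriv ?_
  have h3 : charTransform (fun t => (bernoulliDensity t : ℂ) * (c + t * I) ^ (k + 1)) z =
      c * charTransform (fun t => (bernoulliDensity t : ℂ) * (c + t * I) ^ k) z +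
      charTransform (fun t => I * t * ((bernoulliDensity t : ℂ) * (c + t * I) ^ k)) z := by
    simp only [charTransform]
    rw [← integral_const_mul, ← integral_add ((h1.integrable_mul_cexp (by linarith)).const_mul c)
      (h2.integrable_mul_cexp hz)]
    congr 1
    ext t
    ring
  rw [bernoulliMoment, h3]
  ring

/-- The generating-function form of `(B+1)ᵏ - Bᵏ = k`: the factor `e^z · 2 sinh(z/2)` cancels the
denominator of the transform. Differentiating `k` times and setting `z = 0` gives the relation
itself. -/
lemma bernoulliMoment_zero_sub (z : ℝ) :
    bernoulliMoment (3 / 2) 0 z - bernoulliMoment (1 / 2) 0 z = z * cexp z := by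
  simp only [bernoulliMoment, pow_zero, mul_one]
  rcases eq_or_ne z 0 with rfl | hz
  · simp
  · have hs : Complex.sinh (z / 2) ≠ 0 := by
      have : Real.sinh (z / 2) ≠ 0 := by
        rw [Ne, Real.sinh_eq_zero]; simpa using hz
      exact_mod_cast (ofReal_ne_zero.2 this)
    rw [charTransform_bernoulliDensity hz, ← sub_mul]
    have h1 : cexp (3 / 2 * z) = cexp z * cexp (z / 2) := by rw [← Complex.exp_add]; ring_nf
    have h2 : cexp (1 / 2 * z) = cexp z * cexp (-(z / 2)) := by rw [← Complex.exp_add]; ring_nf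
    have h3 : cexp (z / 2) - cexp (-(z / 2)) = 2 * Complex.sinh (z / 2) := by
      rw [Complex.sinh]; ring
    rw [h1, h2, ← mul_sub, h3]
    push_cast
    field_simp

lemma bernoulliMoment_sub (k : ℕ) (z : ℝ) :
    bernoulliMoment (3 / 2) k z - bernoulliMoment (1 / 2) k z = (z + k) * cexp z := by
  induction k generalizing z with
  | zero => simpa using bernoulliMoment_zero_sub z
  | succ k ih =>
    have hz : |((z : ℝ) : ℂ).im| < Real.pi := by simpa using Real.pi_pos
    have h1 := ((hasDerivAt_bernoulliMoment (3 / 2) k hz).sub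
      (hasDerivAt_bernoulliMoment (1 / 2) k hz)).comp_ofReal
    have h2 : HasDerivAt (fun x : ℝ => ((x : ℂ) + k) * cexp x) ((z + (k + 1 : ℕ)) * cexp z) z := by
      refine (((hasDerivAt_id (z : ℂ)).add_const (k : ℂ)).mul
        (Complex.hasDerivAt_exp (z : ℂ))).comp_ofReal.congr_deriv ?_
      push_cast
      simp only [id]
      ring
    exact h1.unique (h2.congr_of_eventuallyEq (Eventually.of_forall ih))

lemma bernoulliMoment_zero_right (c : ℂ) (k : ℕ) :
    bernoulliMoment c k 0 = ∫ t : ℝ, (bernoulliDensity t : ℂ) * (c + t * I) ^ k := by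
  simp [bernoulliMoment, charTransform]

lemma integrable_bernoulliDensity_mul_pow (c : ℂ) (k : ℕ) :
    Integrable fun t : ℝ => (bernoulliDensity t : ℂ) * (c + t * I) ^ k :=
  (isExpBounded_bernoulliDensity_mul_pow c k Real.pi (by linarith [Real.pi_pos])).integrable
    Real.pi_pos

lemma sum_choose_mul_bernoulliEval_pow (n : ℕ) :
    ∑ k ∈ Finset.range n, (n.choose k : ℂ) * bernoulliEval (fun w => w ^ k) = n := by
  have h := bernoulliMoment_sub n 0
  simp only [ofReal_zero, Complex.exp_zero, mul_one, zero_add, bernoulliMoment_zero_right] at h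
  have h1 : ∫ t : ℝ, (bernoulliDensity t : ℂ) * (3 / 2 + t * I) ^ n =
      ∑ k ∈ Finset.range (n + 1), (n.choose k : ℂ) * bernoulliEval (fun w => w ^ k) := by
    simp only [bernoulliEval, ← integral_const_mul]
    rw [← integral_finsetSum _ fun k _ => (integrable_bernoulliDensity_mul_pow _ k).const_mul _]
    congr 1
    ext t
    rw [show (3 / 2 + t * I : ℂ) = (1 / 2 + t * I) + 1 by ring, add_pow, Finset.mul_sum]
    refine Finset.sum_congr rfl fun k _ => ?_
    rw [one_pow]
    ring
  rw [h1, Finset.sum_range_succ, Nat.choose_self, Nat.cast_one, one_mul] at h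
  rw [← h, bernoulliEval]
  ring

/-- The binomial expansion of `(B+1)^(n+1) - B^(n+1) = n+1` is the recursion defining `bernoulli'`;
the coefficient `n+1` of the top term is nonzero, so the recursion determines the moments. -/
lemma bernoulliEval_pow (n : ℕ) : bernoulliEval (fun w => w ^ n) = ((bernoulli' n : ℚ) : ℂ) := by
  induction n using Nat.strong_induction_on with
  | _ n ih =>
    have h1 := sum_choose_mul_bernoulliEval_pow (n + 1)
    have h2 := congrArg (fun x : ℚ => (x : ℂ)) (sum_bernoulli' (n + 1))
    push_cast at h1 h2
    rw [← h2, Finset.sum_range_succ, Finset.sum_range_succ] at h1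
    rw [Finset.sum_congr rfl fun k hk => by rw [ih k (Finset.mem_range.1 hk)]] at h1
    have h3 := add_left_cancel h1
    refine mul_left_cancel₀ ?_ h3
    rw [Nat.choose_succ_self_right]
    exact_mod_cast Nat.succ_ne_zero n

lemma exp_neg_bernoulli_eq (t z : ℝ) :
    cexp (-(1 / 2 + t * I) * z) = cexp (-z / 2) * cexp (I * t * ((-z : ℝ) : ℂ)) := by
  rw [← Complex.exp_add]
  congr 1
  push_cast
  ring

lemma sin_pi_mul_bernoulli (t : ℝ) :
    Complex.sin (Real.pi * (1 / 2 + t * I)) = (Real.cosh (Real.pi * t) : ℂ) := by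
  rw [show (Real.pi * (1 / 2 + t * I) : ℂ) = (Real.pi * t : ℂ) * I + Real.pi / 2 by ring,
    Complex.sin_add_pi_div_two, cos_mul_I]
  push_cast
  rfl

lemma bernoulliEval_exp {z : ℝ} (hz : z ≠ 0) :
    BernoulliEvaluable (fun w => cexp (-w * z)) ∧
      bernoulliEval (fun w => cexp (-w * z)) = (z : ℂ) / (cexp z - 1) := by
  have hfun : (fun t : ℝ => (bernoulliDensity t : ℂ) * cexp (-(1 / 2 + t * I) * z)) =
      fun t : ℝ => cexp (-z / 2) * ((bernoulliDensity t : ℂ) * cexp (I * t * ((-z : ℝ) : ℂ))) := by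
    ext t
    rw [exp_neg_bernoulli_eq]
    ring
  constructor
  · rw [BernoulliEvaluable, hfun]
    exact (isExpBounded_bernoulliDensity.integrable_mul_cexp
      (by simpa using Real.pi_pos)).const_mul _
  · rw [bernoulliEval, hfun, integral_const_mul]
    change cexp (-z / 2) * charTransform (fun t => (bernoulliDensity t : ℂ)) ((-z : ℝ) : ℂ) = _
    rw [charTransform_bernoulliDensity (neg_ne_zero.2 hz), neg_div 2 z, Real.sinh_neg, neg_div_neg_eq]
    have hs : Real.sinh (z / 2) ≠ 0 := by
      rw [Ne, Real.sinh_eq_zero]; simpa using hz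
    have he : Real.exp z - 1 ≠ 0 := by
      rw [sub_ne_zero]; simpa using hz
    have h1 : Real.exp z - 1 = Real.exp (z / 2) * (2 * Real.sinh (z / 2)) := by
      have h2 : Real.exp z = Real.exp (z / 2) * Real.exp (z / 2) := by rw [← Real.exp_add]; ring_nf
      have h3 : Real.exp (z / 2) * Real.exp (-(z / 2)) = 1 := by rw [← Real.exp_add]; simp
      rw [Real.sinh_eq]
      linear_combination h2 + h3
    have h4 : Real.exp (-z / 2) * (z / 2 / Real.sinh (z / 2)) = z / (Real.exp z - 1) := by
      rw [h1, neg_div, Real.exp_neg]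
      field_simp
    exact_mod_cast congrArg (fun x : ℝ => (x : ℂ)) h4

lemma bernoulliEval_sin_mul_exp (z : ℝ) :
    BernoulliEvaluable (fun w => Complex.sin (Real.pi * w) * cexp (-w * z)) ∧
      bernoulliEval (fun w => Complex.sin (Real.pi * w) * cexp (-w * z)) =
        (Real.pi : ℂ) / (cexp z + 1) := by
  have hfun : (fun t : ℝ => (bernoulliDensity t : ℂ) *
      (Complex.sin (Real.pi * (1 / 2 + t * I)) * cexp (-(1 / 2 + t * I) * z))) =
      fun t : ℝ => cexp (-z / 2) * ((bernoulliDensity t : ℂ) * Real.cosh (Real.pi * t) *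
        cexp (I * t * ((-z : ℝ) : ℂ))) := by
    ext t
    rw [exp_neg_bernoulli_eq, sin_pi_mul_bernoulli]
    ring
  constructor
  · rw [BernoulliEvaluable, hfun]
    exact (isExpBounded_cosh_weight.integrable_mul_cexp
      (by simpa using Real.pi_pos)).const_mul _
  · rw [bernoulliEval, hfun, integral_const_mul]
    change cexp (-z / 2) * charTransform
      (fun t => (bernoulliDensity t : ℂ) * Real.cosh (Real.pi * t)) ((-z : ℝ) : ℂ) = _
    rw [charTransform_cosh_weight, neg_div 2 z, Real.cosh_neg]
    have h1 : Real.exp z + 1 = Real.exp (z / 2) * (2 * Real.cosh (z / 2)) := by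
      have h2 : Real.exp z = Real.exp (z / 2) * Real.exp (z / 2) := by rw [← Real.exp_add]; ring_nf
      have h3 : Real.exp (z / 2) * Real.exp (-(z / 2)) = 1 := by rw [← Real.exp_add]; simp
      rw [Real.cosh_eq]
      linear_combination h2 - h3
    have h4 : Real.exp (-z / 2) * (Real.pi / (2 * Real.cosh (z / 2))) =
        Real.pi / (Real.exp z + 1) := by
      rw [h1, neg_div, Real.exp_neg]
      have := (Real.cosh_pos (z / 2)).ne'
      field_simp
    exact_mod_cast congrArg (fun x : ℝ => (x : ℂ)) h4

/-! ### Integral representations, functional equations, positivity -/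

lemma charTransform_neg {p : ℝ → ℂ} (hp : ∀ t, p (-t) = p t) (w : ℂ) :
    charTransform p (-w) = charTransform p w := by
  rw [charTransform, charTransform, ← integral_neg_eq_self]
  congr 1
  ext t
  rw [hp]
  congr 2
  push_cast
  ring

lemma IsExpBounded.continuous_charTransform_ofReal {p : ℝ → ℂ} {b : ℝ} (h : IsExpBounded p b)
    (hb : 0 < b) : Continuous fun u : ℝ => charTransform p u :=
  continuous_iff_continuousAt.2 fun u =>
    (h.hasDerivAt_charTransform (w := u) (by simpa using hb)).continuousAt.comp (f := ofReal)
      continuous_ofReal.continuousAt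

section

variable {p : ℝ → ℂ} {b : ℝ}

/-- Because `|e^(itu)| = 1`, the absolute value splits as a product of a function of `t` and a
function of `u`. -/
lemma integrable_prod_weight_xiKernel (h : IsExpBounded p b) (hb : 0 < b) (s : ℂ) :
    Integrable (fun z : ℝ × ℝ => p z.1 * (xiKernel z.2 * cexp ((z.1 * I + s) * z.2)))
      (volume.prod volume) := by
  have h1 := (h.integrable hb).mul_prod (integrable_xiKernel_mul_exp s)
  have hc1 := h.continuous
  have hc2 := continuous_xiKernel_ofReal
  refine h1.mono ?_ (Eventually.of_forall fun z => ?_)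
  · have : Continuous fun z : ℝ × ℝ => p z.1 * (xiKernel z.2 * cexp ((z.1 * I + s) * z.2)) := by
      have h3 : Continuous fun z : ℝ × ℝ => xiKernel z.2 := hc2.comp continuous_snd
      fun_prop
    exact this.aestronglyMeasurable
  · rw [norm_mul, norm_mul, norm_mul, norm_mul, add_mul, Complex.exp_add, norm_mul,
      show (z.1 * I * z.2 : ℂ) = ((z.1 * z.2 : ℝ) : ℂ) * I by push_cast; ring,
      norm_exp_ofReal_mul_I, one_mul]

lemma weight_mul_entireXi (p : ℝ → ℂ) (s : ℂ) (t : ℝ) :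
    p t * entireXi (1 / 2 + t * I + s) =
      ∫ u : ℝ, p t * (xiKernel u * cexp ((t * I + s) * u)) := by
  rw [add_assoc, entireXi_eq_integral, integral_const_mul]

lemma integrable_weight_mul_entireXi (h : IsExpBounded p b) (hb : 0 < b) (s : ℂ) :
    Integrable fun t : ℝ => p t * entireXi (1 / 2 + t * I + s) := by
  simp only [weight_mul_entireXi]
  exact (integrable_prod_weight_xiKernel h hb s).integral_prod_left

lemma integral_weight_mul_entireXi (h : IsExpBounded p b) (hb : 0 < b) (s : ℂ) :
    ∫ t : ℝ, p t * entireXi (1 / 2 + t * I + s) =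
      ∫ u : ℝ, xiKernel u * charTransform p u * cexp (s * u) := by
  simp only [weight_mul_entireXi]
  rw [integral_integral_swap (integrable_prod_weight_xiKernel h hb s)]
  congr 1
  ext u
  rw [charTransform, mul_right_comm, ← integral_const_mul]
  congr 1
  ext t
  rw [add_mul, Complex.exp_add]
  ring_nf

lemma integrable_xiKernel_mul_charTransform_mul_exp (h : IsExpBounded p b) (hb : 0 < b) (s : ℂ) :
    Integrable fun u : ℝ => xiKernel u * charTransform p u * cexp (s * u) := by
  obtain ⟨C, -, hC⟩ := h.norm_charTransform_le hb
  have hc := h.continuous_charTransform_ofReal hb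
  refine ((integrable_xiKernel_mul_exp s).mul_bdd (c := C) hc.aestronglyMeasurable
    (Eventually.of_forall fun u => hC u (by simp))).congr (Eventually.of_forall fun u => ?_)
  simp only
  ring

lemma image_exp_two_mul_Ioi : (fun u : ℝ => Real.exp (2 * u)) '' Ioi 0 = Ioi 1 := by
  ext x
  simp only [mem_image, mem_Ioi]
  refine ⟨fun ⟨u, hu, h⟩ => h ▸ Real.one_lt_exp_iff.2 (by linarith), fun hx =>
    ⟨Real.log x / 2, by have := Real.log_pos hx; positivity, ?_⟩⟩
  rw [mul_div_cancel₀ _ two_ne_zero, Real.exp_log (by linarith)]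

lemma ofReal_exp_two_mul_cpow (u : ℝ) (s : ℂ) :
    ((Real.exp (2 * u) : ℝ) : ℂ) ^ (s / 2) = cexp (s * u) := by
  rw [ofReal_exp, cpow_def_of_ne_zero (Complex.exp_ne_zero _), ← ofReal_exp,
    ← ofReal_log (Real.exp_pos _).le, Real.log_exp]
  congr 1; push_cast; ring

/-- The Laplace transform of an even kernel as a Mellin-type integral over `x > 1`. -/
lemma integral_weight_eq_integral_Ioi (h : IsExpBounded p b) (hb : 0 < b)
    (heven : ∀ t, p (-t) = p t) {φ : ℝ → ℝ}
    (hφ : ∀ u : ℝ, 0 < u → ((2 * Real.exp (2 * u) * φ (Real.exp (2 * u)) : ℝ) : ℂ) =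
      xiKernel u * charTransform p u) (s : ℂ) :
    IntegrableOn (fun x : ℝ => (φ x : ℂ) * ((x : ℂ) ^ (s / 2) + (x : ℂ) ^ (-s / 2))) (Ioi 1) ∧
    ∫ t : ℝ, p t * entireXi (1 / 2 + t * I + s) =
      ∫ x in Ioi (1 : ℝ), (φ x : ℂ) * ((x : ℂ) ^ (s / 2) + (x : ℂ) ^ (-s / 2)) := by
  have hint := integrable_xiKernel_mul_charTransform_mul_exp h hb s
  have hint' := integrable_xiKernel_mul_charTransform_mul_exp h hb (-s)
  have hpt : ∀ u ∈ Ioi (0 : ℝ), |2 * Real.exp (2 * u)| • ((φ (Real.exp (2 * u)) : ℂ) *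
      (((Real.exp (2 * u) : ℝ) : ℂ) ^ (s / 2) + ((Real.exp (2 * u) : ℝ) : ℂ) ^ (-s / 2))) =
      xiKernel u * charTransform p u * cexp (s * u) +
        xiKernel u * charTransform p u * cexp (-s * u) := by
    intro u hu
    rw [ofReal_exp_two_mul_cpow, ofReal_exp_two_mul_cpow, ← mul_add, ← hφ u hu,
      abs_of_pos (by positivity), real_smul]
    push_cast
    ring
  have hneg : ∀ u : ℝ, xiKernel (-u : ℝ) * charTransform p (-u : ℝ) * cexp (s * (-u : ℝ)) =
      xiKernel u * charTransform p u * cexp (-s * u) := by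
    intro u
    rw [ofReal_neg, xiKernel_neg (by simpa using Real.pi_pos), charTransform_neg heven]
    ring_nf
  constructor
  · rw [← image_exp_two_mul_Ioi, integrableOn_image_iff_integrableOn_abs_deriv_smul measurableSet_Ioi
      (fun u _ => (hasDerivAt_exp_two_mul u).hasDerivWithinAt) injective_exp_two_mul.injOn]
    exact (hint.add hint').integrableOn.congr_fun (fun u hu => (hpt u hu).symm) measurableSet_Ioi
  · rw [integral_weight_mul_entireXi h hb, integral_eq_integral_Ioi_add_neg hint,
      ← image_exp_two_mul_Ioi, integral_image_eq_integral_abs_deriv_smul measurableSet_Ioi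
      (fun u _ => (hasDerivAt_exp_two_mul u).hasDerivWithinAt) injective_exp_two_mul.injOn]
    refine setIntegral_congr_fun measurableSet_Ioi fun u hu => ?_
    rw [hpt u hu, hneg]

end

lemma bernoulliDensity_neg (t : ℝ) : bernoulliDensity (-t) = bernoulliDensity t := by
  rw [bernoulliDensity, bernoulliDensity, mul_neg, Real.cosh_neg]

lemma sqrt_exp_two_mul (u : ℝ) : Real.sqrt (Real.exp (2 * u)) = Real.exp u := by
  rw [two_mul, Real.exp_add, Real.sqrt_mul_self (Real.exp_pos _).le]

/-- With `x = e^(2u)`, `log x / (√x - 1) = 2u / (2 e^(u/2) sinh(u/2))`, which carries the transform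
of the density; the factor `2e^(2u)` is the Jacobian. -/
lemma phiXi_exp {u : ℝ} (hu : 0 < u) :
    ((2 * Real.exp (2 * u) * phiXi (Real.exp (2 * u)) : ℝ) : ℂ) =
      xiKernel u * charTransform (fun t => (bernoulliDensity t : ℂ)) u := by
  rw [xiKernel_ofReal, charTransform_bernoulliDensity hu.ne', ← ofReal_mul, phiXi, sqrt_exp_two_mul,
    Real.log_exp]
  congr 1
  have h3 : Real.exp (2 * u) = Real.exp (3 * u / 2) * Real.exp (u / 2) := by
    rw [← Real.exp_add]; ring_nf
  have h1 : Real.exp u - 1 = Real.exp (u / 2) * (2 * Real.sinh (u / 2)) := by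
    have h2 : Real.exp u = Real.exp (u / 2) * Real.exp (u / 2) := by rw [← Real.exp_add]; ring_nf
    have h3 : Real.exp (u / 2) * Real.exp (-(u / 2)) = 1 := by rw [← Real.exp_add]; simp
    rw [Real.sinh_eq]
    linear_combination h2 + h3
  have hs : Real.sinh (u / 2) ≠ 0 := (Real.sinh_pos_iff.2 (by positivity)).ne'
  rw [h1]
  generalize thetaKernel (Real.exp (2 * u)) = κ
  rw [h3]
  field_simp
  ring

lemma phiSinXi_exp (u : ℝ) :
    ((2 * Real.exp (2 * u) * phiSinXi (Real.exp (2 * u)) : ℝ) : ℂ) =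
      xiKernel u * charTransform (fun t => (bernoulliDensity t : ℂ) * Real.cosh (Real.pi * t)) u := by
  rw [xiKernel_ofReal, charTransform_cosh_weight, ← ofReal_mul, phiSinXi, sqrt_exp_two_mul]
  congr 1
  have h3 : Real.exp (2 * u) = Real.exp (3 * u / 2) * Real.exp (u / 2) := by
    rw [← Real.exp_add]; ring_nf
  have h1 : Real.exp u + 1 = Real.exp (u / 2) * (2 * Real.cosh (u / 2)) := by
    have h2 : Real.exp u = Real.exp (u / 2) * Real.exp (u / 2) := by rw [← Real.exp_add]; ring_nf
    have h3 : Real.exp (u / 2) * Real.exp (-(u / 2)) = 1 := by rw [← Real.exp_add]; simp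
    rw [Real.cosh_eq]
    linear_combination h2 - h3
  have hs : Real.cosh (u / 2) ≠ 0 := (Real.cosh_pos _).ne'
  rw [h1]
  generalize thetaKernel (Real.exp (2 * u)) = κ
  rw [h3]
  field_simp
  ring

lemma xiB_eq_weight (s : ℂ) :
    xiB s = ∫ t : ℝ, (fun t => (bernoulliDensity t : ℂ)) t * entireXi (1 / 2 + t * I + s) := rfl

lemma sin_mul_entireXi_eq_weight (s : ℂ) :
    (fun t : ℝ => (bernoulliDensity t : ℂ) * (Complex.sin (Real.pi * (1 / 2 + t * I)) *
      entireXi (1 / 2 + t * I + s))) = fun t : ℝ =>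
      (fun t => (bernoulliDensity t : ℂ) * Real.cosh (Real.pi * t)) t *
        entireXi (1 / 2 + t * I + s) := by
  ext t
  rw [sin_pi_mul_bernoulli, mul_assoc]

lemma sinXiB_eq_weight (s : ℂ) :
    sinXiB s = ∫ t : ℝ, (fun t => (bernoulliDensity t : ℂ) * Real.cosh (Real.pi * t)) t *
      entireXi (1 / 2 + t * I + s) := by
  rw [sinXiB, bernoulliEval, sin_mul_entireXi_eq_weight]

lemma bernoulliEvaluable_entireXi (s : ℂ) : BernoulliEvaluable fun w => entireXi (w + s) :=
  integrable_weight_mul_entireXi isExpBounded_bernoulliDensity (by positivity) s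

lemma bernoulliEvaluable_sin_mul_entireXi (s : ℂ) :
    BernoulliEvaluable fun w => Complex.sin (Real.pi * w) * entireXi (w + s) := by
  rw [BernoulliEvaluable, sin_mul_entireXi_eq_weight]
  exact integrable_weight_mul_entireXi isExpBounded_cosh_weight Real.pi_pos s

lemma xiB_eq_integral (s : ℂ) :
    IntegrableOn (fun x : ℝ => (phiXi x : ℂ) * ((x : ℂ) ^ (s / 2) + (x : ℂ) ^ (-s / 2))) (Ioi 1) ∧
    xiB s = ∫ x in Ioi (1 : ℝ), (phiXi x : ℂ) * ((x : ℂ) ^ (s / 2) + (x : ℂ) ^ (-s / 2)) := by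
  rw [xiB_eq_weight]
  exact integral_weight_eq_integral_Ioi isExpBounded_bernoulliDensity (by positivity)
    (fun t => by rw [bernoulliDensity_neg]) (fun u hu => phiXi_exp hu) s

lemma sinXiB_eq_integral (s : ℂ) :
    IntegrableOn (fun x : ℝ => (phiSinXi x : ℂ) * ((x : ℂ) ^ (s / 2) + (x : ℂ) ^ (-s / 2)))
      (Ioi 1) ∧
    sinXiB s = ∫ x in Ioi (1 : ℝ), (phiSinXi x : ℂ) * ((x : ℂ) ^ (s / 2) + (x : ℂ) ^ (-s / 2)) := by
  rw [sinXiB_eq_weight]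
  exact integral_weight_eq_integral_Ioi isExpBounded_cosh_weight Real.pi_pos
    (fun t => by rw [bernoulliDensity_neg, mul_neg, Real.cosh_neg]) (fun u _ => phiSinXi_exp u) s

lemma xiB_neg (s : ℂ) : xiB (-s) = xiB s := by
  rw [(xiB_eq_integral s).2, (xiB_eq_integral (-s)).2, neg_neg]
  simp only [add_comm]

lemma sinXiB_neg (s : ℂ) : sinXiB (-s) = sinXiB s := by
  rw [(sinXiB_eq_integral s).2, (sinXiB_eq_integral (-s)).2, neg_neg]
  simp only [add_comm]

lemma phiXi_pos {x : ℝ} (hx : 1 < x) : 0 < phiXi x := by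
  have h1 : 1 < Real.sqrt x := by rwa [Real.lt_sqrt zero_le_one, one_pow]
  exact mul_pos (thetaKernel_pos hx) (div_pos (Real.log_pos hx) (sub_pos.2 h1))

lemma phiSinXi_pos {x : ℝ} (hx : 1 < x) : 0 < phiSinXi x :=
  mul_pos (thetaKernel_pos hx) (by have := Real.pi_pos; positivity)

lemma integral_Ioi_real_pos {φ : ℝ → ℝ} (hφ : ∀ x, 1 < x → 0 < φ x) (σ : ℝ)
    (hint : IntegrableOn (fun x : ℝ => (φ x : ℂ) * ((x : ℂ) ^ ((σ : ℂ) / 2) +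
      (x : ℂ) ^ (-(σ : ℂ) / 2))) (Ioi 1)) {X : ℂ}
    (hX : X = ∫ x in Ioi (1 : ℝ), (φ x : ℂ) * ((x : ℂ) ^ ((σ : ℂ) / 2) +
      (x : ℂ) ^ (-(σ : ℂ) / 2))) : X.im = 0 ∧ 0 < X.re := by
  have hpt : EqOn (fun x : ℝ => (φ x : ℂ) * ((x : ℂ) ^ ((σ : ℂ) / 2) + (x : ℂ) ^ (-(σ : ℂ) / 2)))
      (fun x : ℝ => ((φ x * (x ^ (σ / 2) + x ^ (-σ / 2)) : ℝ) : ℂ)) (Ioi 1) := by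
    intro x hx
    have hx0 : 0 ≤ x := zero_le_one.trans (le_of_lt hx)
    push_cast [ofReal_cpow hx0]
    rfl
  have hint2 := (hint.congr_fun hpt measurableSet_Ioi).re
  simp only [RCLike.re_to_complex, ofReal_re] at hint2
  rw [setIntegral_congr_fun measurableSet_Ioi hpt, integral_complex_ofReal] at hX
  have hpos : ∀ x ∈ Ioi (1 : ℝ), 0 < φ x * (x ^ (σ / 2) + x ^ (-σ / 2)) := by
    intro x hx
    have hx0 : 0 < x := zero_lt_one.trans hx
    have := hφ x hx
    positivity
  rw [hX, ofReal_im, ofReal_re]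
  refine ⟨rfl, ?_⟩
  rw [setIntegral_pos_iff_support_of_nonneg_ae
    ((ae_restrict_mem measurableSet_Ioi).mono fun x hx => (hpos x hx).le) hint2]
  have : Function.support (fun x => φ x * (x ^ (σ / 2) + x ^ (-σ / 2))) ∩ Ioi 1 = Ioi 1 :=
    inter_eq_right.2 fun x hx => (hpos x hx).ne'
  rw [this]
  simp

/-! ### Flatness of theta at the cusp `-1` -/

/-- Translation by `-1` multiplies the `n`-th term by `(-1)ⁿ`, so odd terms cancel and even ones
double. -/
lemma jacobiTheta_sub_one_add {t : ℂ} (ht : 0 < t.im) :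
    jacobiTheta (t - 1) + jacobiTheta t = 2 * jacobiTheta (4 * t) := by
  have hs : ∀ {τ : ℂ}, 0 < τ.im → Summable fun n : ℤ => cexp (Real.pi * I * (n : ℂ) ^ 2 * τ) := by
    intro τ hτ
    have := (hasSum_jacobiTheta₂_term 0 hτ).summable
    simpa [jacobiTheta₂_term] using this
  have ht1 : 0 < (t - 1).im := by simpa using ht
  rw [jacobiTheta, jacobiTheta, jacobiTheta, ← (hs ht1).tsum_add (hs ht), ← tsum_mul_left]
  have hinj : Function.Injective fun m : ℤ => 2 * m := mul_right_injective₀ two_ne_zero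
  rw [← hinj.tsum_eq]
  · refine tsum_congr fun m => ?_
    have h1 : cexp (Real.pi * I * ((2 * m : ℤ) : ℂ) ^ 2 * (t - 1)) =
        cexp (Real.pi * I * (m : ℂ) ^ 2 * (4 * t)) := by
      rw [Complex.exp_eq_exp_iff_exists_int]
      refine ⟨-(2 * m ^ 2), ?_⟩
      push_cast
      ring
    have h2 : Real.pi * I * ((2 * m : ℤ) : ℂ) ^ 2 * t = Real.pi * I * (m : ℂ) ^ 2 * (4 * t) := by
      push_cast
      ring
    rw [h1, h2]
    ring
  · intro n hn
    rw [Function.mem_support] at hn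
    by_contra hne
    have hodd : Odd n := by
      rw [← Int.not_even_iff_odd]
      rintro ⟨m, hm⟩
      exact hne ⟨m, by simp only; omega⟩
    refine hn ?_
    obtain ⟨m, rfl⟩ := hodd
    have h1 : cexp (Real.pi * I * ((2 * m + 1 : ℤ) : ℂ) ^ 2 * (t - 1)) =
        cexp (Real.pi * I * ((2 * m + 1 : ℤ) : ℂ) ^ 2 * t + Real.pi * I) := by
      rw [Complex.exp_eq_exp_iff_exists_int]
      refine ⟨-(2 * m ^ 2 + 2 * m + 1), ?_⟩
      push_cast
      ring
    rw [h1, Complex.exp_add, Complex.exp_pi_mul_I]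
    ring

lemma jacobiTheta_neg_inv {t : ℂ} (ht : 0 < t.im) :
    jacobiTheta (-t⁻¹) = (-I * t) ^ (1 / 2 : ℂ) * jacobiTheta t := by
  have h := jacobiTheta_S_smul ⟨t, ht⟩
  rw [UpperHalfPlane.modular_S_smul] at h
  simpa only [inv_neg] using h

/-- Inversion moves the cusp to `i∞`. Both theta values on the right have constant term `1`, and
these cancel, leaving only exponentially small terms. -/
lemma sqrt_mul_jacobiTheta_sub_one {t : ℂ} (ht : 0 < t.im) :
    (-I * t) ^ (1 / 2 : ℂ) * jacobiTheta (t - 1) =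
      jacobiTheta (-(4 * t)⁻¹) - jacobiTheta (-t⁻¹) := by
  have h4 : 0 < (4 * t).im := by simpa using ht
  have ht0 : -I * t ≠ 0 := mul_ne_zero (neg_ne_zero.2 I_ne_zero) (by rintro rfl; simp at ht)
  have hr : (-I * (4 * t)) ^ (1 / 2 : ℂ) = 2 * (-I * t) ^ (1 / 2 : ℂ) := by
    have h1 : -I * (4 * t) = ((4 : ℝ) : ℂ) * (-I * t) := by push_cast; ring
    rw [h1, cpow_def_of_ne_zero (mul_ne_zero (by norm_num) ht0), cpow_def_of_ne_zero ht0,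
      log_ofReal_mul (by norm_num) ht0, add_mul, Complex.exp_add]
    congr 1
    have : Real.log 4 = 2 * Real.log 2 := by
      rw [show (4 : ℝ) = 2 ^ 2 by norm_num, Real.log_pow]; norm_num
    rw [this]
    have h2 : ((2 * Real.log 2 : ℝ) : ℂ) * (1 / 2) = ((Real.log 2 : ℝ) : ℂ) := by push_cast; ring
    rw [h2, ← ofReal_exp, Real.exp_log two_pos]
    norm_num
  rw [jacobiTheta_neg_inv ht, jacobiTheta_neg_inv h4, hr]
  linear_combination (-I * t) ^ (1 / 2 : ℂ) * jacobiTheta_sub_one_add ht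

lemma norm_jacobiTheta_sub_one_le_exp {τ : ℂ} {Y : ℝ} (hY : 1 ≤ Y) (hτ : Y ≤ τ.im) :
    ‖jacobiTheta τ - 1‖ ≤ 4 * Real.exp (-Y) := by
  refine (norm_jacobiTheta_sub_one_le (by linarith)).trans ?_
  have h1 : Real.exp (-Real.pi * τ.im) ≤ Real.exp (-Y) :=
    Real.exp_le_exp.2 (by nlinarith [Real.pi_gt_three])
  have h2 : Real.exp (-Y) ≤ 1 / 2 := by
    have : Real.exp (-Y) ≤ Real.exp (-1) := Real.exp_le_exp.2 (by linarith)
    have := Real.exp_neg_one_lt_half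
    linarith
  have h3 : 2 / (1 - Real.exp (-Real.pi * τ.im)) ≤ 4 := by
    rw [div_le_iff₀ (by linarith)]; linarith
  gcongr

/-- The theta function is flat at the cusp `-1`. -/
lemma norm_jacobiTheta_sub_one_cusp_le {t : ℂ} {δ : ℝ} (hδ : 0 < δ) (hδ1 : δ < 1 / 3000)
    (him : δ / 12 ≤ t.im) (hnorm : ‖t‖ ≤ 7 * δ) :
    ‖jacobiTheta (t - 1)‖ ≤ 96 / δ * Real.exp (-(1 / (2352 * δ))) := by
  have ht : 0 < t.im := by linarith [show 0 < δ / 12 by positivity]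
  have ht0 : t ≠ 0 := by rintro rfl; simp at ht
  have hY : 1 ≤ 1 / (2352 * δ) := by rw [le_div_iff₀ (by positivity)]; linarith
  -- `im(-1/t) = im t / |t|² ≥ (δ/12)/(49δ²) = 4/(2352δ)`; the point `-1/(4t)` has a quarter of this
  -- height.
  have hinv : 4 * (1 / (2352 * δ)) ≤ (-t⁻¹).im := by
    rw [neg_im, inv_im, neg_div, neg_neg, normSq_eq_norm_sq, le_div_iff₀ (by positivity)]
    have : ‖t‖ ^ 2 ≤ (7 * δ) ^ 2 := by gcongr
    calc 4 * (1 / (2352 * δ)) * ‖t‖ ^ 2 ≤ 4 * (1 / (2352 * δ)) * (7 * δ) ^ 2 := by gcongr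
      _ = δ / 12 := by field_simp; norm_num
      _ ≤ t.im := him
  have hinv4 : 1 / (2352 * δ) ≤ (-(4 * t)⁻¹).im := by
    have : -(4 * t)⁻¹ = ((1 / 4 : ℝ) : ℂ) * (-t⁻¹) := by
      push_cast; field_simp
    rw [this, im_ofReal_mul]
    linarith
  have h1 := norm_jacobiTheta_sub_one_le_exp hY hinv4
  have h2 := norm_jacobiTheta_sub_one_le_exp hY (τ := -t⁻¹) (by linarith)
  have h3 : ‖(-I * t) ^ (1 / 2 : ℂ)‖ * ‖jacobiTheta (t - 1)‖ ≤ 8 * Real.exp (-(1 / (2352 * δ))) := by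
    rw [← norm_mul, sqrt_mul_jacobiTheta_sub_one ht]
    calc _ = ‖(jacobiTheta (-(4 * t)⁻¹) - 1) - (jacobiTheta (-t⁻¹) - 1)‖ := by congr 1; ring
      _ ≤ _ := (norm_sub_le _ _).trans (by linarith)
  have h4 : δ / 12 ≤ ‖(-I * t) ^ (1 / 2 : ℂ)‖ := by
    have h5 : ‖(-I * t) ^ (1 / 2 : ℂ)‖ ^ 2 = ‖t‖ := by
      rw [← norm_pow, ← cpow_nat_mul]
      simp
    have h6 : δ / 12 ≤ ‖t‖ := him.trans ((le_abs_self _).trans (abs_im_le_norm t))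
    refine le_of_sq_le_sq ?_ (norm_nonneg _)
    rw [h5]
    refine le_trans ?_ h6
    nlinarith
  have h5 : δ / 12 * ‖jacobiTheta (t - 1)‖ ≤ 8 * Real.exp (-(1 / (2352 * δ))) :=
    (mul_le_mul_of_nonneg_right h4 (norm_nonneg _)).trans h3
  calc _ = 12 / δ * (δ / 12 * ‖jacobiTheta (t - 1)‖) := by field_simp
    _ ≤ 12 / δ * (8 * Real.exp (-(1 / (2352 * δ)))) := by gcongr
    _ = _ := by ring

lemma norm_thetaExp_near_le {δ : ℝ} (hδ : 0 < δ) (hδ1 : δ < 1 / 3000) {z : ℂ}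
    (hz : ‖z - ((Real.pi / 4 - δ : ℝ) : ℂ) * I‖ ≤ 3 / 4 * δ) :
    ‖thetaExp z‖ ≤ 192 / δ * Real.exp (-(1 / (2352 * δ))) := by
  set ζ := z - ((Real.pi / 4 - δ : ℝ) : ℂ) * I with hζ
  have hre : |z.re| ≤ 3 / 4 * δ := by
    have := (abs_re_le_norm ζ).trans hz
    simpa [hζ] using this
  have him : |z.im - (Real.pi / 4 - δ)| ≤ 3 / 4 * δ := by
    have := (abs_im_le_norm ζ).trans hz
    simpa [hζ] using this
  rw [abs_le] at hre him
  have hpi := Real.pi_gt_three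
  set t : ℂ := I * cexp (2 * z) + 1 with ht
  have h1 : t = -(cexp (-2 * I * (δ + I * ζ)) - 1) := by
    have : 2 * z = -2 * I * (δ + I * ζ) + Real.pi / 2 * I := by
      rw [hζ]; push_cast
      linear_combination (2 * (z - (Real.pi / 4 - δ) * I)) * I_sq
    rw [ht, this, Complex.exp_add, Complex.exp_pi_div_two_mul_I]
    linear_combination cexp (-2 * I * (δ + I * ζ)) * I_sq
  -- `2(δ + 3δ/4) = 7δ/2`, and `|e^η - 1| ≤ 2|η|` then gives `7δ`.
  have hη : ‖-2 * I * (δ + I * ζ)‖ ≤ 7 / 2 * δ := by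
    rw [norm_mul, norm_mul, norm_neg, Complex.norm_ofNat, norm_I, mul_one]
    have : ‖(δ : ℂ) + I * ζ‖ ≤ δ + 3 / 4 * δ := by
      refine (norm_add_le _ _).trans (add_le_add ?_ ?_)
      · rw [norm_real, Real.norm_of_nonneg hδ.le]
      · rwa [norm_mul, norm_I, one_mul]
    linarith
  have hnorm : ‖t‖ ≤ 7 * δ := by
    rw [h1, norm_neg]
    refine (norm_exp_sub_one_le (hη.trans (by linarith))).trans ?_
    linarith
  have htim : δ / 12 ≤ t.im := by
    have h2 : t.im = Real.exp (2 * z.re) * Real.cos (2 * z.im) := by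
      rw [ht, ← re_exp_two_mul]; simp
    -- Jordan's inequality for `π/2 - 2 im z ≥ δ/2`, together with `π ≤ 4`.
    have h3 : δ / 4 ≤ Real.cos (2 * z.im) := by
      rw [← Real.sin_pi_div_two_sub]
      have h4 := Real.mul_le_sin (x := Real.pi / 2 - 2 * z.im) (by linarith) (by linarith)
      refine le_trans ?_ h4
      rw [div_mul_eq_mul_div, le_div_iff₀ Real.pi_pos]
      nlinarith [Real.pi_le_four]
    have h5 : 1 / 3 ≤ Real.exp (2 * z.re) := by
      have := Real.add_one_le_exp (2 * z.re)
      linarith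
    rw [h2]
    calc δ / 12 = 1 / 3 * (δ / 4) := by ring
      _ ≤ _ := by gcongr
  have h6 := norm_jacobiTheta_sub_one_cusp_le hδ hδ1 htim hnorm
  rw [ht, add_sub_cancel_right] at h6
  rw [thetaExp, norm_mul, norm_cexp_half]
  have h7 : Real.exp (z.re / 2) ≤ 2 := by
    have : Real.exp (z.re / 2) ≤ Real.exp (1 / 2) := Real.exp_le_exp.2 (by linarith)
    have h8 : Real.exp (1 / 2) ^ 2 = Real.exp 1 := by rw [← Real.exp_nat_mul]; norm_num
    nlinarith [Real.exp_one_lt_d9, Real.exp_pos (1 / 2)]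
  calc _ ≤ 2 * (96 / δ * Real.exp (-(1 / (2352 * δ)))) := by gcongr
    _ = _ := by ring

lemma iteratedDeriv_two_thetaExp {w : ℂ} (hw : |w.im| < Real.pi / 4) :
    iteratedDeriv 2 thetaExp w = thetaExp w / 4 + 2 * xiKernel w := by
  rw [iteratedDeriv_succ, iteratedDeriv_one]
  have h1 : deriv thetaExp =ᶠ[𝓝 w] fun w => cexp (w / 2) / 2 + 2 * psiExpDeriv w :=
    eventuallyEq_of_strip (fun z hz => (hasDerivAt_thetaExp hz).deriv) hw
  rw [h1.deriv_eq]
  refine ((((hasDerivAt_cexp_half w).div_const 2).add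
    ((hasDerivAt_psiExpDeriv hw).const_mul 2)).deriv).trans ?_
  rw [thetaExp_eq hw]; ring

lemma abs_im_lt_of_near {δ : ℝ} (hδ : 0 < δ) (hδ1 : δ < 1 / 3000) {z : ℂ}
    (hz : ‖z - ((Real.pi / 4 - δ : ℝ) : ℂ) * I‖ ≤ 3 / 4 * δ) : |z.im| < Real.pi / 4 := by
  have him : |z.im - (Real.pi / 4 - δ)| ≤ 3 / 4 * δ := by
    have := (abs_im_le_norm (z - ((Real.pi / 4 - δ : ℝ) : ℂ) * I)).trans hz
    simpa using this
  rw [abs_le] at him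
  have hpi := Real.pi_gt_three
  rw [abs_lt]
  constructor <;> linarith

lemma norm_xiKernel_near_le {δ : ℝ} (hδ : 0 < δ) (hδ1 : δ < 1 / 3000) {z : ℂ}
    (hz : ‖z - ((Real.pi / 4 - δ : ℝ) : ℂ) * I‖ ≤ 1 / 2 * δ) :
    ‖xiKernel z‖ ≤ 4000 / δ ^ 3 * Real.exp (-(1 / (2352 * δ))) := by
  set E := Real.exp (-(1 / (2352 * δ))) with hE
  have hE0 : 0 < E := Real.exp_pos _
  have hsub : ∀ w ∈ Metric.closedBall z (δ / 4),
      ‖w - ((Real.pi / 4 - δ : ℝ) : ℂ) * I‖ ≤ 3 / 4 * δ := by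
    intro w hw
    rw [mem_closedBall_iff_norm] at hw
    have := norm_add_le (w - z) (z - ((Real.pi / 4 - δ : ℝ) : ℂ) * I)
    rw [sub_add_sub_cancel] at this
    linarith
  have hd : DiffContOnCl ℂ thetaExp (Metric.ball z (δ / 4)) := by
    refine DifferentiableOn.diffContOnCl_ball (U := Metric.closedBall z (δ / 4)) ?_ subset_rfl
    intro w hw
    exact (hasDerivAt_thetaExp (abs_im_lt_of_near hδ hδ1 (hsub w hw))).differentiableAt.differentiableWithinAt
  -- Cauchy's estimate for `Θ''` on radius `δ/4`: with `z` within `δ/2` of the centre, the circle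
  -- stays within the `3δ/4` where theta is controlled.
  have h1 := norm_iteratedDeriv_le_of_forall_mem_sphere_norm_le 2 (by positivity : 0 < δ / 4) hd
    fun w hw => norm_thetaExp_near_le hδ hδ1 (hsub w (Metric.sphere_subset_closedBall hw))
  have hz' := hsub z (Metric.mem_closedBall_self (by positivity))
  have h2 := norm_thetaExp_near_le hδ hδ1 hz'
  rw [iteratedDeriv_two_thetaExp (abs_im_lt_of_near hδ hδ1 hz')] at h1
  have h3 : xiKernel z = ((thetaExp z / 4 + 2 * xiKernel z) - thetaExp z / 4) / 2 := by ring
  rw [← hE] at h1 h2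
  rw [h3, norm_div, Complex.norm_ofNat]
  have h4 : ‖thetaExp z / 4‖ ≤ 192 / δ * E / 4 := by
    rw [norm_div, Complex.norm_ofNat]; gcongr
  have h5 := (norm_sub_le (thetaExp z / 4 + 2 * xiKernel z) (thetaExp z / 4)).trans (add_le_add h1 h4)
  have h6 : (Nat.factorial 2 : ℝ) * (192 / δ * E) / (δ / 4) ^ 2 = 6144 / δ ^ 3 * E := by
    norm_num [Nat.factorial]
    field_simp
    norm_num
  have h7 : 192 / δ * E / 4 ≤ 48 / δ ^ 3 * E := by
    have : 1 / δ ≤ 1 / δ ^ 3 := by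
      apply one_div_le_one_div_of_le (by positivity)
      calc δ ^ 3 ≤ δ ^ 1 := pow_le_pow_of_le_one hδ.le (by linarith) (by norm_num)
        _ = δ := pow_one δ
    calc 192 / δ * E / 4 = 48 * (1 / δ) * E := by ring
      _ ≤ 48 * (1 / δ ^ 3) * E := by gcongr
      _ = _ := by ring
  rw [h6] at h5
  have h8 : 0 < E / δ ^ 3 := by positivity
  calc _ ≤ (6144 / δ ^ 3 * E + 48 / δ ^ 3 * E) / 2 := by gcongr; linarith
    _ = 3096 * (E / δ ^ 3) := by ring
    _ ≤ 4000 * (E / δ ^ 3) := by gcongr; norm_num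
    _ = _ := by ring

/-! ### Infinitely many zeros on the imaginary axis -/

section

variable {p : ℝ → ℂ} {b : ℝ}

lemma isStripDecaying_xiKernel_mul (h : IsExpBounded p b) (hb : Real.pi / 4 < b) :
    IsStripDecaying (fun w => xiKernel w * charTransform p w) (Real.pi / 4) where
  differentiableOn := differentiableOn_xiKernel.mul fun w hw =>
    (h.hasDerivAt_charTransform (lt_trans hw hb)).differentiableAt.differentiableWithinAt
  decay α hα := by
    obtain ⟨C, hC0, hC⟩ := norm_xiKernel_le hα 1
    obtain ⟨D, hD0, hD⟩ := h.norm_charTransform_le (hα.trans hb)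
    refine ⟨C * D, fun w hw => ?_⟩
    rw [norm_mul, mul_right_comm]
    have := hC w hw
    rw [neg_one_mul] at this
    gcongr
    exact hD w hw

lemma tendsto_iteratedDeriv_xiKernel_mul (h : IsExpBounded p b) (hb : Real.pi / 4 < b) (n : ℕ) :
    Tendsto (fun α : ℝ => iteratedDeriv n (fun w => xiKernel w * charTransform p w) (α * I))
      (𝓝[<] (Real.pi / 4)) (𝓝 0) := by
  obtain ⟨D, hD0, hD⟩ := h.norm_charTransform_le hb
  have hS := isStripDecaying_xiKernel_mul h hb
  -- With `δ = π/4 - α`, Cauchy's estimate on radius `δ/2` loses only `δ^(-n)`, and `δ^(-(n+3))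
  -- e^(-1/(2352δ))` still tends to `0`.
  have hlim : Tendsto (fun α : ℝ => (n.factorial * (4000 * D) * 2 ^ n) *
      ((Real.pi / 4 - α)⁻¹ ^ (n + 3) * Real.exp (-(1 / 2352) * (Real.pi / 4 - α)⁻¹)))
      (𝓝[<] (Real.pi / 4)) (𝓝 0) := by
    have h1 : Tendsto (fun α : ℝ => (Real.pi / 4 - α)⁻¹) (𝓝[<] (Real.pi / 4)) atTop := by
      refine tendsto_inv_nhdsGT_zero.comp ?_
      refine tendsto_nhdsWithin_iff.2 ⟨?_, ?_⟩
      · have : Tendsto (fun α : ℝ => Real.pi / 4 - α) (𝓝 (Real.pi / 4)) (𝓝 (Real.pi / 4 - Real.pi / 4)) :=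
          (continuous_const.sub continuous_id).tendsto _
        rw [sub_self] at this
        exact this.mono_left nhdsWithin_le_nhds
      · filter_upwards [self_mem_nhdsWithin] with α hα using sub_pos.2 (mem_Iio.1 hα)
    have h2 := (tendsto_rpow_mul_exp_neg_mul_atTop_nhds_zero ((n + 3 : ℕ) : ℝ) (1 / 2352)
      (by norm_num)).comp h1
    simp only [Function.comp_def, Real.rpow_natCast] at h2
    have h3 := h2.const_mul (n.factorial * (4000 * D) * 2 ^ n : ℝ)
    rwa [mul_zero] at h3
  refine squeeze_zero_norm' ?_ hlim
  filter_upwards [Ioo_mem_nhdsLT (show Real.pi / 4 - 1 / 3000 < Real.pi / 4 by norm_num)] with α hα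
  set δ := Real.pi / 4 - α with hδ
  have hδ0 : 0 < δ := sub_pos.2 hα.2
  have hδ1 : δ < 1 / 3000 := by linarith [hα.1]
  have hαδ : α = Real.pi / 4 - δ := by rw [hδ]; ring
  have hsub : ∀ w ∈ Metric.closedBall ((α : ℂ) * I) (δ / 2),
      ‖w - ((Real.pi / 4 - δ : ℝ) : ℂ) * I‖ ≤ 1 / 2 * δ := by
    intro w hw
    rw [mem_closedBall_iff_norm] at hw
    rw [← hαδ]
    linarith
  have hstrip : ∀ w ∈ Metric.closedBall ((α : ℂ) * I) (δ / 2), |w.im| < Real.pi / 4 := fun w hw =>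
    abs_im_lt_of_near hδ0 hδ1 ((hsub w hw).trans (by linarith))
  have hd : DiffContOnCl ℂ (fun w => xiKernel w * charTransform p w)
      (Metric.ball ((α : ℂ) * I) (δ / 2)) :=
    (hS.differentiableOn.mono hstrip).diffContOnCl_ball subset_rfl
  refine (norm_iteratedDeriv_le_of_forall_mem_sphere_norm_le n (by positivity : 0 < δ / 2) hd
    (C := 4000 / δ ^ 3 * Real.exp (-(1 / (2352 * δ))) * D) fun w hw => ?_).trans_eq ?_
  · have hw' := Metric.sphere_subset_closedBall hw
    rw [norm_mul]
    gcongr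
    · exact norm_xiKernel_near_le hδ0 hδ1 (hsub w hw')
    · exact hD w (hstrip w hw').le
  · have : -(1 / (2352 * δ)) = -(1 / 2352) * δ⁻¹ := by field_simp
    rw [this, div_pow, inv_pow, pow_add]
    field_simp

/-- The transform of `ξ` along an imaginary line against an even real weight has infinitely many
zeros. -/
lemma infinite_zeros_weight (h : IsExpBounded p b) (hb : Real.pi / 4 < b)
    (heven : ∀ t, p (-t) = p t) (hreal : ∀ t, (starRingEnd ℂ) (p t) = p t) {X : ℂ → ℂ}
    (hX : ∀ s, X s = ∫ t : ℝ, p t * entireXi (1 / 2 + t * I + s)) :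
    {t : ℝ | X ((t : ℂ) * I) = 0}.Infinite := by
  have hb0 : 0 < b := lt_trans (by positivity) hb
  have h1 := (isStripDecaying_xiKernel_mul h hb).infinite_zeros_fourier (by positivity)
    (fun u => by rw [xiKernel_neg (by simpa using Real.pi_pos), charTransform_neg heven])
    (fun u => by
      rw [map_mul, xiKernel_ofReal, conj_ofReal]
      congr 1
      refine Eq.trans ?_ (charTransform_neg heven (u : ℂ))
      rw [charTransform, charTransform, ← integral_conj]
      congr 1
      ext t
      rw [map_mul, hreal, ← exp_conj]
      simp)
    (tendsto_iteratedDeriv_xiKernel_mul h hb)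
  -- A zero `ξ` of the transform, normalised with `e^(-2πiuξ)`, corresponds to `s = -2πiξ`.
  have hinj : Function.Injective fun ξ : ℝ => -2 * Real.pi * ξ :=
    mul_right_injective₀ (by simp [Real.pi_ne_zero])
  refine (h1.image hinj.injOn).mono ?_
  rintro _ ⟨ξ, hξ, rfl⟩
  replace hξ : 𝓕 (fun u : ℝ => xiKernel u * charTransform p u) ξ = 0 := hξ
  change X (((-2 * Real.pi * ξ : ℝ) : ℂ) * I) = 0
  rw [hX, integral_weight_mul_entireXi h hb0, ← hξ, Real.fourier_real_eq_integral_exp_smul]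
  congr 1
  ext u
  rw [smul_eq_mul, mul_comm]
  congr 2
  push_cast
  ring

end

theorem theorem2p1 :
    -- the operator: `Bⁿ = Bₙ`, `e^(-Bz) = z/(e^z - 1)`, `sin(πB) e^(-Bz) = π/(e^z + 1)`
    (∀ n : ℕ, BernoulliEvaluable (fun w => w ^ n) ∧
      bernoulliEval (fun w => w ^ n) = ((bernoulli' n : ℚ) : ℂ)) ∧
    (∀ z : ℝ, z ≠ 0 → BernoulliEvaluable (fun w => Complex.exp (-w * z)) ∧
      bernoulliEval (fun w => Complex.exp (-w * z)) = (z : ℂ) / (Complex.exp z - 1)) ∧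
    (∀ z : ℝ, BernoulliEvaluable
        (fun w => Complex.sin (Real.pi * w) * Complex.exp (-w * z)) ∧
      bernoulliEval (fun w => Complex.sin (Real.pi * w) * Complex.exp (-w * z)) =
        (Real.pi : ℂ) / (Complex.exp z + 1)) ∧
    -- `ξ(B + s)` and `sin(πB) ξ(B + s)` are well defined for every complex `s`
    (∀ s : ℂ, BernoulliEvaluable (fun w => entireXi (w + s)) ∧
      BernoulliEvaluable (fun w => Complex.sin (Real.pi * w) * entireXi (w + s))) ∧
    -- the integral representations
    (∀ s : ℂ,
      MeasureTheory.IntegrableOn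
        (fun x : ℝ => (phiXi x : ℂ) * ((x : ℂ) ^ (s / 2) + (x : ℂ) ^ (-s / 2))) (Set.Ioi 1) ∧
      xiB s = ∫ x in Set.Ioi (1 : ℝ),
        (phiXi x : ℂ) * ((x : ℂ) ^ (s / 2) + (x : ℂ) ^ (-s / 2))) ∧
    (∀ s : ℂ,
      MeasureTheory.IntegrableOn
        (fun x : ℝ => (phiSinXi x : ℂ) * ((x : ℂ) ^ (s / 2) + (x : ℂ) ^ (-s / 2))) (Set.Ioi 1) ∧
      sinXiB s = ∫ x in Set.Ioi (1 : ℝ),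
        (phiSinXi x : ℂ) * ((x : ℂ) ^ (s / 2) + (x : ℂ) ^ (-s / 2))) ∧
    -- the functional equations
    (∀ s : ℂ, bernoulliEval (fun w => entireXi (w + s)) =
      bernoulliEval (fun w => entireXi (w - s))) ∧
    (∀ s : ℂ, bernoulliEval (fun w => Complex.sin (Real.pi * w) * entireXi (w + s)) =
      bernoulliEval (fun w => Complex.sin (Real.pi * w) * entireXi (w - s))) ∧
    -- positivity on the real axis
    (∀ σ : ℝ, (xiB (σ : ℂ)).im = 0 ∧ 0 < (xiB (σ : ℂ)).re) ∧
    (∀ σ : ℝ, (sinXiB (σ : ℂ)).im = 0 ∧ 0 < (sinXiB (σ : ℂ)).re) ∧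
    -- infinitely many zeros on the imaginary axis
    {t : ℝ | xiB ((t : ℂ) * Complex.I) = 0}.Infinite ∧
    {t : ℝ | sinXiB ((t : ℂ) * Complex.I) = 0}.Infinite := by
  refine ⟨fun n => ⟨integrable_bernoulliDensity_mul_pow _ n, bernoulliEval_pow n⟩,
    fun z hz => bernoulliEval_exp hz, bernoulliEval_sin_mul_exp,
    fun s => ⟨bernoulliEvaluable_entireXi s, bernoulliEvaluable_sin_mul_entireXi s⟩,
    xiB_eq_integral, sinXiB_eq_integral, fun s => ?_, fun s => ?_,
    fun σ => integral_Ioi_real_pos (fun _ => phiXi_pos) σ (xiB_eq_integral σ).1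
      (xiB_eq_integral σ).2,
    fun σ => integral_Ioi_real_pos (fun _ => phiSinXi_pos) σ (sinXiB_eq_integral σ).1
      (sinXiB_eq_integral σ).2, ?_, ?_⟩
  · simpa only [sub_eq_add_neg] using! (xiB_neg s).symm
  · simpa only [sub_eq_add_neg] using! (sinXiB_neg s).symm
  -- The decay rates of the two weights, `2π` and `π`, both exceed `π/4`, so the transforms stay
  -- bounded up to the edge of the strip of the kernel.
  · exact infinite_zeros_weight isExpBounded_bernoulliDensity (by linarith [Real.pi_pos])
      (fun t => by rw [bernoulliDensity_neg]) (fun t => conj_ofReal _) xiB_eq_weight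
  · exact infinite_zeros_weight isExpBounded_cosh_weight (by linarith [Real.pi_pos])
      (fun t => by rw [bernoulliDensity_neg, mul_neg, Real.cosh_neg])
      (fun t => by rw [map_mul, conj_ofReal, conj_ofReal]) sinXiB_eq_weight
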